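/- Let $T>0$. There exists a constant $C>0$ depending only on $T$ with the following property. Let $u_1\in L^1(\mathbb R)$ be real-valued with $\operatorname{supp}u_1\subset[0,T]$, and let $y_1\in C([0,+\infty),L^2(0,1))\cap L^2_{\rm loc}((0,+\infty),H^1(0,1))$ be the unique weak solution of $$ \begin{cases} y_{1,t}(t,x)-y_{1,xx}(t,x)=u_1(t) & \text{in }(0,+\infty)\times(0,1),\\ y_1(t,0)=y_1(t,1)=0 & \text{in }(0,+\infty),\\ y_1(0,\cdot)=0 & \text{in }(0,1). \end{cases} $$ Here "weak solution" means that, for every $S>0$, every $\tau\in[0,S]$ and every $\phi\in C([0,S],H^1_0(0,1))\cap L^2((0,S),H^2(0,1))\cap H^1((0,S)\times(0,1))$, $$ \int_0^1 y_1(\tau,x)\phi(\tau,x)\,dx-\int_0^\tau\!\!\int_0^1 y_1(t,x)\,(\phi_t+\phi_{xx})(t,x)\,dx\,dt=\int_0^\tau\!\!\int_0^1 u_1(t)\phi(t,x)\,dx\,dt . $$ If $y_1(T,\cdot)=0$, then $\|u_1\|_{[H^{5/4}(0,T)]^*}<\infty$ and, for $k_0\in\{2,10\}$, $$ \int_0^T\!\!\int_0^1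 y_1^2(t,x)\,\partial_x\phi_{k_0}(t,x)\,dx\,dt\le -C\,\|u_1\|^2_{[H^{5/4}(0,T)]^*}, $$ where $\phi_k(t,x)=e^{\pi^2k^2t}\sin(k\pi x)$. Here $[H^{5/4}(0,T)]^*$ is the dual space of $H^{5/4}(0,T)$ with the dual norm, $u_1$ acting by $\varphi\mapsto\int_0^T u_1\varphi\,dt$, and $H^{5/4}(0,T)$ is the space of restrictions to $(0,T)$ of functions of $H^{5/4}(\mathbb R)$, with the quotient norm $\|\varphi\|_{H^{5/4}(0,T)}=\inf\{\|\Phi\|_{H^{5/4}(\mathbb R)}:\Phi|_{(0,T)}=\varphi\}$, where $\|\Phi\|^2_{H^{5/4}(\mathbb R)}=\int_{\mathbb R}(1+z^2)^{5/4}|\hat\Phi(z)|^2\,dz$ and $\hat\Phi(z)=(2\pi)^{-1/2}\int_{\mathbb R}e^{-izt}\Phi(t)\,dt$. -/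

import Mathlib

noncomputable section

namespace BurgersHeat

open MeasureTheory Set
open scoped ENNReal FourierTransform ContDiff

/-- The space `L²(0,1)` of real-valued functions. -/
abbrev L2 : Type := Lp ℝ 2 (volume.restrict (Ioo (0 : ℝ) 1))

/-- `g` is the weak (distributional) derivative on `(0,1)` of `f`; both are in `L²(0,1)`, so
`f` lies in `H¹(0,1)` as soon as such a `g` exists. -/
def IsWeakDeriv (f g : L2) : Prop :=
  ∀ ψ : ℝ → ℝ, ContDiff ℝ ∞ ψ → HasCompactSupport ψ → tsupport ψ ⊆ Ioo 0 1 →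
    ∫ x in Ioo (0 : ℝ) 1, f x * deriv ψ x = - ∫ x in Ioo (0 : ℝ) 1, g x * ψ x

/-- The continuous representative of `f` on `[0,1]` exists and vanishes at `0` and at `1`. For an
`f` in `H¹(0,1)` this says that `f` has zero trace, that is, `f` lies in `H¹₀(0,1)`. -/
def HasZeroTrace (f : L2) : Prop :=
  ∃ F : ℝ → ℝ, ContinuousOn F (Icc 0 1) ∧ (∀ᵐ x ∂(volume.restrict (Ioo (0 : ℝ) 1)), f x = F x) ∧
    F 0 = 0 ∧ F 1 = 0

/-- `φt` is the weak derivative in time, on `(0,T)`, of the `L²(0,1)`-valued function `φ`. -/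
def IsWeakTimeDeriv (T : ℝ) (φ φt : ℝ → L2) : Prop :=
  ∀ θ : ℝ → ℝ, ContDiff ℝ ∞ θ → HasCompactSupport θ → tsupport θ ⊆ Ioo 0 T →
    ∫ t in Ioo 0 T, deriv θ t • φ t = - ∫ t in Ioo 0 T, θ t • φt t

/-- `φ` is a test function of the heat equation on `[0,T]`, that is, an element of
`C([0,T], H¹₀(0,1)) ∩ L²((0,T), H²(0,1)) ∩ H¹((0,T) × (0,1))`, and `φt`, `φx`, `φxx` are its
weak derivatives. -/
structure IsTestFunction (T : ℝ) (φ φt φx φxx : ℝ → L2) : Prop where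
  continuousOn : ContinuousOn φ (Icc 0 T)
  continuousOn_x : ContinuousOn φx (Icc 0 T)
  weakDeriv_x : ∀ t ∈ Icc 0 T, IsWeakDeriv (φ t) (φx t)
  zeroTrace : ∀ t ∈ Icc 0 T, HasZeroTrace (φ t)
  memLp_xx : MemLp φxx 2 (volume.restrict (Ioo 0 T))
  weakDeriv_xx : ∀ᵐ t ∂(volume.restrict (Ioo 0 T)), IsWeakDeriv (φx t) (φxx t)
  memLp_t : MemLp φt 2 (volume.restrict (Ioo 0 T))
  weakDeriv_t : IsWeakTimeDeriv T φ φt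

/-- `y` is a weak solution of
`y_t - y_xx = u(t)` in `(0,∞) × (0,1)`, `y(t,0) = y(t,1) = 0`, `y(0,·) = y₀`:
it belongs to `C([0,∞), L²(0,1)) ∩ L²_loc((0,∞), H¹(0,1))`, and, for each `T > 0`, it satisfies on
`[0,T]` the weak formulation with final time `τ ∈ [0,T]`. (The boundary condition is encoded by
test functions that vanish at `x = 0, 1` but whose `x`-derivative need not vanish there.) Values
of `y` at negative times are irrelevant. -/
structure IsHeatSolution (u : ℝ → ℝ) (y₀ : L2) (y : ℝ → L2) : Prop where
  continuousOn : ContinuousOn y (Ici 0)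
  memLocH1 : ∃ yx : ℝ → L2,
    (∀ a b : ℝ, 0 < a → a < b → MemLp yx 2 (volume.restrict (Ioo a b))) ∧
    ∀ᵐ t ∂(volume.restrict (Ioi (0 : ℝ))), IsWeakDeriv (y t) (yx t)
  weakForm : ∀ T : ℝ, 0 < T → ∀ φ φt φx φxx : ℝ → L2, IsTestFunction T φ φt φx φxx →
    ∀ τ ∈ Icc 0 T,
      (∫ x in Ioo (0 : ℝ) 1, y τ x * φ τ x) - (∫ x in Ioo (0 : ℝ) 1, y₀ x * φ 0 x)
        - (∫ t in (0 : ℝ)..τ, ∫ x in Ioo (0 : ℝ) 1, y t x * (φt t x + φxx t x))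
      = ∫ t in (0 : ℝ)..τ, ∫ x in Ioo (0 : ℝ) 1, u t * φ t x

/-- `φ_k(t,x) = e^{π² k² t} sin(k π x)`. -/
def phi (k : ℕ) (t x : ℝ) : ℝ :=
  Real.exp (Real.pi ^ 2 * (k : ℝ) ^ 2 * t) * Real.sin ((k : ℝ) * Real.pi * x)

/-- The norm of `H^s(ℝ)`, in `[0,∞]`, of a (complex-valued) function in `L²(ℝ)`, `s ≥ 0`; the
function is in `H^s(ℝ)` iff the value is finite. With the unitary transform in angular frequency,
`Φ̂(z) = (2π)^{-1/2} ∫ e^{-izt} Φ(t) dt`, this is `(∫ (1 + z²)^s |Φ̂(z)|² dz)^{1/2}`; here it is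
written with `𝓕 Φ (ξ) = ∫ e^{-2πiξt} Φ(t) dt`, so that `z = 2πξ`. -/
def sobolevNorm (s : ℝ) (Φ : Lp ℂ 2 (volume : Measure ℝ)) : ℝ≥0∞ :=
  (∫⁻ ξ : ℝ, ENNReal.ofReal ((1 + (2 * Real.pi * ξ) ^ 2) ^ s) *
    ‖(𝓕 Φ : Lp ℂ 2 (volume : Measure ℝ)) ξ‖ₑ ^ 2) ^ (1 / 2 : ℝ)

/-- The norm of `H^s(I)`, in `[0,∞]`, of a function on the open interval `I`: the infimum of the
norms of its extensions in `H^s(ℝ)` (it is `∞` iff there is no such extension, i.e. iff the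
function is not in `H^s(I)`). -/
def sobolevNormOn (s : ℝ) (I : Set ℝ) (φ : ℝ → ℂ) : ℝ≥0∞ :=
  ⨅ (Φ : Lp ℂ 2 (volume : Measure ℝ)) (_ : ∀ᵐ t ∂(volume.restrict I), Φ t = φ t), sobolevNorm s Φ

/-- The norm in the dual space `[H^s(I)]^*`, in `[0,∞]`, of an integrable function `u`, which acts
on `H^s(I)` by `φ ↦ ∫_I u φ`; to be used for `s > 1/2`, where `H^s(I) ⊆ L^∞(I)`. -/
def dualSobolevNorm (s : ℝ) (I : Set ℝ) (u : ℝ → ℝ) : ℝ≥0∞ :=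
  ⨆ (φ : ℝ → ℂ) (_ : sobolevNormOn s I φ ≤ 1), ‖∫ t in I, (u t : ℂ) * φ t‖ₑ

end BurgersHeat

end

noncomputable section

namespace BurgersHeat

open MeasureTheory Set
open scoped ENNReal FourierTransform ContDiff

/-! Write k₀ = 2h with h = 1 or h = 5. Testing the weak formulation with e^{n²π²t} sin(nπx), which
solves the backward equation, makes the sine coefficients of y₁ explicit (`sineCoeff_heatSolution`).
They vanish for even n. For odd n, multiplied by e^{2π²h²t}, they are 2/(nπ) times the solution w_n
of w' + π²(n² - 2h²)w = v, w(0) = 0, where v = e^{2π²h²t}u₁. Since ∂ₓφ_{2h} = 2hπ e^{4π²h²t}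
cos(2hπx), Parseval couples only the modes n and n - 2h. With n = 2l + h, the form is a constant
times the sum over l of ∫ w_{2l+h} w_{2l-h} dt / ((2l+h)(2l-h)).

The condition y₁(T) = 0 forces w_n(T) = 0, so the extension of w_n by zero has transform v̂/(π²(n² -
2h²) + 2πiξ). Plancherel then turns the form into ∫ |v̂|² K with an explicit real kernel K
(`integral_sq_mul_deriv_phi`).

The heart is the bound K ≤ -κ(1 + s²)^{-5/4}, s = 2ξ/π (`exists_kernel_le`). Because the numbers
1/((2l+h)(2l-h)) sum to zero, the l-independent profile 1/(s² + c) can be subtracted from every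
interaction for free. For a good c the resulting remainders add up to a nonnegative quantity equal
to -K, and the indices l ~ |s|^{1/2} contribute about |s|^{1/2} terms of size |s|^{-3}. This is the
origin of the exponent 5/4.

Hence the form is at most a negative multiple of the squared H^{-5/4}(ℝ) norm of v. Multiplication
by a cut-off exponential is bounded on that space, so u₁ is controlled by v
(`exists_dualEnergy_exp_mul_le`), and the H^{-5/4}(ℝ) norm of u₁ dominates its dual norm on (0,T)
(`dualSobolevNorm_le`). It is finite because û₁ is bounded and 5/4 > 1/2. -/

/-! ### The frequency kernel -/

/-- `n² - 2h²`: up to the factor `π²`, the decay rate of the `n`-th sine mode of the heat equation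
after multiplication by the weight `e^{2π²h²t}`. -/
def modeRate (h : ℕ) (n : ℤ) : ℝ := (n : ℝ) ^ 2 - 2 * (h : ℝ) ^ 2

/-- The interaction of the modes `2l + h` and `2l - h` at the frequency `s`. -/
def modeInteraction (h : ℕ) (l : ℤ) (s : ℝ) : ℝ :=
  (modeRate h (2 * l + h) * modeRate h (2 * l - h) + s ^ 2) /
    ((modeRate h (2 * l + h) ^ 2 + s ^ 2) * (modeRate h (2 * l - h) ^ 2 + s ^ 2))

/-- The product `(2l + h)(2l - h)` of the two mode numbers. -/
def modeProd (h : ℕ) (l : ℤ) : ℝ := (2 * (l : ℝ)) ^ 2 - (h : ℝ) ^ 2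

/-- An odd square minus an even number is an odd integer, hence nonzero. Thus no denominator of the
kernel degenerates, even at zero frequency. -/
lemma one_le_modeRate_sq {h : ℕ} {n : ℤ} (hn : Odd n) : 1 ≤ modeRate h n ^ 2 := by
  have h1 : (n ^ 2 - 2 * (h : ℤ) ^ 2) ≠ 0 := by
    have : Odd (n ^ 2 - 2 * (h : ℤ) ^ 2) := (hn.pow).sub_even (even_two_mul _)
    intro h0
    rw [h0] at this
    exact absurd this (by decide)
  have h2 : (1 : ℤ) ≤ (n ^ 2 - 2 * (h : ℤ) ^ 2) ^ 2 := by
    have := sq_pos_of_ne_zero h1 |>.le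
    have h3 := sq_pos_iff.2 h1
    omega
  have h4 : ((1 : ℤ) : ℝ) ≤ (((n ^ 2 - 2 * (h : ℤ) ^ 2) ^ 2 : ℤ) : ℝ) := by exact_mod_cast h2
  push_cast at h4
  simpa [modeRate] using h4

lemma odd_two_mul_add {h : ℕ} (hh : Odd h) (l : ℤ) : Odd (2 * l + h) := by
  have : Odd (h : ℤ) := by exact_mod_cast hh
  exact (even_two_mul l).add_odd this

lemma odd_two_mul_sub {h : ℕ} (hh : Odd h) (l : ℤ) : Odd (2 * l - h) := by
  have : Odd (h : ℤ) := by exact_mod_cast hh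
  exact (even_two_mul l).sub_odd this

/-- By Cauchy–Schwarz for (p, s) and (q, s), the numerator is at most the square root of the
denominator, whose two factors are at least 1 + s². Uniformity in l is what justifies the later
interchanges of sum and integral. -/
lemma abs_modeInteraction_le {h : ℕ} (hh : Odd h) (l : ℤ) (s : ℝ) :
    |modeInteraction h l s| ≤ 1 / (1 + s ^ 2) := by
  unfold modeInteraction
  have h1 := one_le_modeRate_sq (h := h) (odd_two_mul_add hh l)
  have h2 := one_le_modeRate_sq (h := h) (odd_two_mul_sub hh l)
  set p := modeRate h (2 * l + h)
  set q := modeRate h (2 * l - h)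
  have hs := sq_nonneg s
  have hD : (1 + s ^ 2) ^ 2 ≤ (p ^ 2 + s ^ 2) * (q ^ 2 + s ^ 2) := by
    rw [sq (1 + s ^ 2)]
    gcongr
  have hD0 : 0 < (p ^ 2 + s ^ 2) * (q ^ 2 + s ^ 2) := lt_of_lt_of_le (by positivity) hD
  rw [abs_div, abs_of_pos hD0, div_le_div_iff₀ hD0 (by positivity), one_mul]
  have hN : (p * q + s ^ 2) ^ 2 ≤ (p ^ 2 + s ^ 2) * (q ^ 2 + s ^ 2) := by
    nlinarith [mul_nonneg hs (sq_nonneg (p - q))]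
  have h3 : (|p * q + s ^ 2| * (1 + s ^ 2)) ^ 2
      ≤ ((p ^ 2 + s ^ 2) * (q ^ 2 + s ^ 2)) ^ 2 := by
    rw [mul_pow, sq_abs, sq ((p ^ 2 + s ^ 2) * (q ^ 2 + s ^ 2))]
    gcongr
  exact (le_abs_self _).trans (abs_le_of_sq_le_sq h3 hD0.le)

lemma modeProd_ne_zero {h : ℕ} (hh : Odd h) (l : ℤ) : modeProd h l ≠ 0 := by
  have h1 : (2 * l + h : ℤ) ≠ 0 := by
    intro h0; have := odd_two_mul_add hh l; rw [h0] at this; exact absurd this (by decide)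
  have h2 : (2 * l - h : ℤ) ≠ 0 := by
    intro h0; have := odd_two_mul_sub hh l; rw [h0] at this; exact absurd this (by decide)
  have h3 : ((2 * l + h : ℤ) : ℝ) * ((2 * l - h : ℤ) : ℝ) ≠ 0 :=
    mul_ne_zero (by exact_mod_cast h1) (by exact_mod_cast h2)
  push_cast at h3
  unfold modeProd
  intro h0
  apply h3
  linarith [h0, (by ring : (2 * (l : ℝ) + h) * (2 * l - h) = (2 * (l : ℝ)) ^ 2 - (h : ℝ) ^ 2)]

-- Partial sums over [-N, N) telescope to g(-N) - g(N).
open Filter Topology in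
lemma hasSum_int_sub_succ {g : ℤ → ℝ} (hg : Tendsto g cofinite (𝓝 0))
    (hs : Summable fun l => g l - g (l + 1)) : HasSum (fun l => g l - g (l + 1)) 0 := by
  have h1 := hs.hasSum
  have h2 : Tendsto (fun N : ℕ => ∑ l ∈ Finset.Ico (-(N : ℤ)) N, (g l - g (l + 1))) atTop
      (𝓝 (∑' l, (g l - g (l + 1)))) :=
    h1.comp (Finset.tendsto_Ico_neg_atTop_atTop.comp tendsto_natCast_atTop_atTop)
  have h3 : ∀ N : ℕ, ∑ l ∈ Finset.Ico (-(N : ℤ)) N, (g l - g (l + 1)) = g (-N) - g N := by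
    intro N
    induction N with
    | zero => simp
    | succ N ih =>
      have : Finset.Ico (-((N + 1 : ℕ) : ℤ)) ((N + 1 : ℕ) : ℤ)
          = insert (-((N : ℤ) + 1)) (insert (N : ℤ) (Finset.Ico (-(N : ℤ)) N)) := by
        ext x; simp only [Finset.mem_Ico, Finset.mem_insert]; push_cast; omega
      rw [this, Finset.sum_insert, Finset.sum_insert, ih]
      · push_cast
        rw [show -((N : ℤ) + 1) + 1 = -N by ring]
        ring
      · simp
      · simp only [Finset.mem_Ico, Finset.mem_insert]; omega
  simp only [h3] at h2
  have h4 : Tendsto (fun N : ℕ => g (-(N : ℤ))) atTop (𝓝 0) := by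
    have hi : Function.Injective (fun N : ℕ => -(N : ℤ)) := fun a b hab => by simpa using hab
    have := hg.comp hi.tendsto_cofinite
    rwa [Nat.cofinite_eq_atTop] at this
  have h5 : Tendsto (fun N : ℕ => g (N : ℤ)) atTop (𝓝 0) := by
    have hi : Function.Injective (fun N : ℕ => (N : ℤ)) := fun a b hab => by simpa using hab
    have := hg.comp hi.tendsto_cofinite
    rwa [Nat.cofinite_eq_atTop] at this
  have h6 := tendsto_nhds_unique h2 (by simpa using h4.sub h5)
  rwa [h6] at h1

-- Partial fractions: with g(l) = 1/(2l - h) the term is (g(l) - g(l + h))/(2h), a sum of h unit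
-- steps, each of which telescopes to zero over ℤ.
open Filter Topology in
lemma hasSum_inv_modeProd {h : ℕ} (hh : Odd h) : HasSum (fun l => (modeProd h l)⁻¹) 0 := by
  have hp : 0 < (h : ℝ) := by exact_mod_cast hh.pos
  set g : ℤ → ℝ := fun l => (2 * (l : ℝ) - h)⁻¹ with hgdef
  have hne : ∀ l : ℤ, 2 * (l : ℝ) - h ≠ 0 := by
    intro l h0
    have h2 : (2 * l - h : ℤ) = 0 := by exact_mod_cast h0
    have := odd_two_mul_sub hh l
    rw [h2] at this; exact absurd this (by decide)
  have hg2 : Summable fun l => g l ^ 2 := by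
    have := (Real.summable_one_div_int_add_rpow (-(h / 2 : ℝ)) 2).2 (by norm_num)
    refine (this.mul_left (1 / 4)).congr fun l => ?_
    have e : (2 * (l : ℝ) - h) = 2 * ((l : ℝ) + -(h / 2 : ℝ)) := by ring
    rw [hgdef]
    simp only
    rw [e, Real.rpow_two, sq_abs, mul_inv, mul_pow]
    norm_num
  have hg2' : Summable fun l => g (l + 1) ^ 2 :=
    (Equiv.addRight (1 : ℤ)).summable_iff (f := fun l => g l ^ 2) |>.2 hg2
  have hg0 : Tendsto g cofinite (𝓝 0) := by
    have := hg2.tendsto_cofinite_zero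
    have h2 := this.sqrt
    simp only [Real.sqrt_sq_eq_abs, Real.sqrt_zero] at h2
    exact (tendsto_zero_iff_abs_tendsto_zero _).2 h2
  have hG : Summable fun l => g l - g (l + 1) := by
    refine Summable.of_norm_bounded (hg2.add hg2') fun l => ?_
    have e : g l - g (l + 1) = 2 * (g l * g (l + 1)) := by
      simp only [hgdef]
      have a := hne l
      have b := hne (l + 1)
      push_cast at b ⊢
      field_simp
      ring
    rw [e, Real.norm_eq_abs, abs_mul, abs_mul, abs_two]
    nlinarith [sq_nonneg (|g l| - |g (l + 1)|), sq_abs (g l), sq_abs (g (l + 1))]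
  have h0 := hasSum_int_sub_succ hg0 hG
  have hj : ∀ j ∈ Finset.range h, HasSum (fun l : ℤ => g (l + j) - g (l + j + 1)) 0 := fun j _ =>
    (Equiv.addRight (j : ℤ)).hasSum_iff (f := fun l => g l - g (l + 1)) |>.2 h0
  have h1 := (hasSum_sum hj).mul_left (1 / (2 * (h : ℝ)))
  simp only [Finset.sum_const_zero, mul_zero] at h1
  refine (congrArg (fun F : ℤ → ℝ => HasSum F 0) (funext fun l => ?_)).mpr h1
  have e : ∑ j ∈ Finset.range h, (g (l + j) - g (l + j + 1)) = g l - g (l + h) := by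
    have := Finset.sum_range_sub' (fun j : ℕ => g (l + j)) h
    simpa [add_assoc] using this
  simp only [e]
  simp only [hgdef, modeProd]
  have a := hne l
  have b := hne (l + h)
  push_cast at b ⊢
  have b' : 2 * (l : ℝ) + h ≠ 0 := by convert b using 1; ring
  rw [show 2 * ((l : ℝ) + h) - h = 2 * l + h by ring,
    show (2 * (l : ℝ)) ^ 2 - (h : ℝ) ^ 2 = (2 * l + h) * (2 * l - h) by ring]
  field_simp
  ring

lemma summable_inv_modeProd_mul {h : ℕ} (hh : Odd h) {f : ℤ → ℝ} {M : ℝ} (hf : ∀ l, |f l| ≤ M) :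
    Summable fun l => (modeProd h l)⁻¹ * f l := by
  have h1 := (hasSum_inv_modeProd hh).summable.abs
  refine Summable.of_norm_bounded (h1.mul_right M) fun l => ?_
  rw [Real.norm_eq_abs, abs_mul]
  exact mul_le_mul_of_nonneg_left (hf l) (abs_nonneg _)

/-- The numerator of the remainder of `modeProd⁻¹ * modeInteraction` after subtraction of
`modeProd⁻¹ / (s² + c)`. -/
def remainderNum (h : ℕ) (c : ℝ) (l : ℤ) (s : ℝ) : ℝ :=
  s ^ 2 * (modeProd h l ^ 2 + 12 * (h : ℝ) ^ 2 * (2 * (l : ℝ)) ^ 2 - c) +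
    (modeRate h (2 * l + h) * modeRate h (2 * l - h)) *
      (modeRate h (2 * l + h) * modeRate h (2 * l - h) - c)

/-- With p, q the two rates, the s⁴ terms cancel over the common denominator, leaving the numerator
s²(p² + q² - pq - c) + pq(pq - c). Its sign can be read off from the two coefficients. -/
def remainderTerm (h : ℕ) (c : ℝ) (l : ℤ) (s : ℝ) : ℝ :=
  (modeProd h l)⁻¹ * (remainderNum h c l s /
    (((modeRate h (2 * l + h) ^ 2 + s ^ 2) * (modeRate h (2 * l - h) ^ 2 + s ^ 2)) * (s ^ 2 + c)))

lemma remainderTerm_eq {h : ℕ} (hh : Odd h) {c : ℝ} (hc : 0 < c) (l : ℤ) (s : ℝ) :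
    remainderTerm h c l s =
      (modeProd h l)⁻¹ * (s ^ 2 + c)⁻¹ - (modeProd h l)⁻¹ * modeInteraction h l s := by
  have h1 := one_le_modeRate_sq (h := h) (odd_two_mul_add hh l)
  have h2 := one_le_modeRate_sq (h := h) (odd_two_mul_sub hh l)
  unfold remainderTerm modeInteraction remainderNum
  rw [← mul_sub]
  congr 1
  have e : modeProd h l ^ 2 + 12 * (h : ℝ) ^ 2 * (2 * (l : ℝ)) ^ 2 =
      modeRate h (2 * l + h) ^ 2 + modeRate h (2 * l - h) ^ 2
        - modeRate h (2 * l + h) * modeRate h (2 * l - h) := by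
    simp only [modeProd, modeRate]
    push_cast
    ring
  rw [e]
  set p := modeRate h (2 * l + h)
  set q := modeRate h (2 * l - h)
  have hp : p ^ 2 + s ^ 2 ≠ 0 := by positivity
  have hq : q ^ 2 + s ^ 2 ≠ 0 := by positivity
  have hs : s ^ 2 + c ≠ 0 := by positivity
  field_simp
  ring

/-- The subtracted profile sums to zero, so c is a free parameter, to be chosen to make the
remainders nonnegative. -/
lemma hasSum_remainderTerm {h : ℕ} (hh : Odd h) {c : ℝ} (hc : 0 < c) (s : ℝ) :
    HasSum (fun l => remainderTerm h c l s) (-∑' l, (modeProd h l)⁻¹ * modeInteraction h l s) := by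
  have h1 := (hasSum_inv_modeProd hh).mul_right (s ^ 2 + c)⁻¹
  have h2 := (summable_inv_modeProd_mul hh (fun l => abs_modeInteraction_le hh l s)).hasSum
  have := h1.sub h2
  simp only [zero_mul, zero_sub] at this
  simpa only [remainderTerm_eq hh hc] using this

lemma remainderTerm_nonneg {h : ℕ} {c : ℝ} (hc : 0 < c) {l : ℤ} {s : ℝ}
    (h1 : 0 ≤ modeProd h l) (h2 : 0 ≤ remainderNum h c l s) : 0 ≤ remainderTerm h c l s := by
  unfold remainderTerm
  positivity

lemma modeRate_mul_modeRate (h : ℕ) (l : ℤ) :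
    modeRate h (2 * l + h) * modeRate h (2 * l - h) =
      (2 * (l : ℝ)) ^ 4 - 6 * (h : ℝ) ^ 2 * (2 * (l : ℝ)) ^ 2 + (h : ℝ) ^ 4 := by
  simp only [modeRate]
  push_cast
  ring

/-- The choice c = 1 makes the numerator at l = 0 vanish identically. For the other l, the product
pq of the rates is -7 if |l| = 1 and at least 161 otherwise, so pq(pq - 1) ≥ 0. -/
lemma remainderTerm_nonneg_of_one_le {s : ℝ} {l : ℤ} (hl : 1 ≤ |l|) :
    0 ≤ remainderTerm 1 1 l s := by
  have h1 : (1 : ℝ) ≤ (l : ℝ) ^ 2 := by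
    have h0 : (1 : ℤ) ≤ l ^ 2 := by rw [← sq_abs]; nlinarith
    exact_mod_cast h0
  apply remainderTerm_nonneg one_pos
  · simp only [modeProd]; push_cast; nlinarith
  · unfold remainderNum
    rw [modeRate_mul_modeRate]
    simp only [modeProd]
    push_cast
    have h2 : l ^ 2 = 1 ∨ 4 ≤ l ^ 2 := by
      rcases eq_or_lt_of_le hl with h | h
      · left; rw [← sq_abs, ← h]; norm_num
      · right; rw [← sq_abs]; nlinarith
    have h3 : 0 ≤ (((2 * (l : ℝ)) ^ 2 - 1 ^ 2) ^ 2 + 12 * 1 ^ 2 * (2 * (l : ℝ)) ^ 2 - 1) := by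
      nlinarith
    rcases h2 with h | h
    · have h' : (l : ℝ) ^ 2 = 1 := by exact_mod_cast h
      have e : (2 * (l : ℝ)) ^ 4 = 16 := by rw [mul_pow, show (l : ℝ) ^ 4 = (l ^ 2) ^ 2 by ring, h']; norm_num
      have e2 : (2 * (l : ℝ)) ^ 2 = 4 := by rw [mul_pow, h']; norm_num
      rw [e, e2]
      nlinarith [sq_nonneg s]
    · have h' : (4 : ℝ) ≤ (l : ℝ) ^ 2 := by exact_mod_cast h
      have e : 1 ≤ (2 * (l : ℝ)) ^ 4 - 6 * 1 ^ 2 * (2 * (l : ℝ)) ^ 2 + 1 ^ 4 := by nlinarith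
      have := mul_nonneg (sq_nonneg s) h3
      nlinarith

/-- The product pq of the rates is negative for 4 ≤ |l| ≤ 6 and at least 9641 for |l| ≥ 7. It never
falls between 0 and c = 6000, so pq(pq - c) ≥ 0. -/
lemma remainderTerm_nonneg_of_four_le {s : ℝ} {l : ℤ} (hl : 4 ≤ |l|) :
    0 ≤ remainderTerm 5 6000 l s := by
  have h1 : (16 : ℝ) ≤ (l : ℝ) ^ 2 := by
    have h0 : (16 : ℤ) ≤ l ^ 2 := by rw [← sq_abs]; nlinarith
    exact_mod_cast h0
  apply remainderTerm_nonneg (by norm_num)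
  · simp only [modeProd]; push_cast; nlinarith
  · unfold remainderNum
    rw [modeRate_mul_modeRate]
    simp only [modeProd]
    push_cast
    have h2 : l ^ 2 ≤ 36 ∨ 49 ≤ l ^ 2 := by
      rcases lt_or_ge |l| 7 with h | h
      · left; rw [← sq_abs]; nlinarith [abs_nonneg l]
      · right; rw [← sq_abs]; nlinarith
    have h3 : 0 ≤ (((2 * (l : ℝ)) ^ 2 - 5 ^ 2) ^ 2 + 12 * 5 ^ 2 * (2 * (l : ℝ)) ^ 2 - 6000) := by
      nlinarith
    have h4 := mul_nonneg (sq_nonneg s) h3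
    rcases h2 with h | h
    · have h' : (l : ℝ) ^ 2 ≤ 36 := by exact_mod_cast h
      have e : (2 * (l : ℝ)) ^ 4 - 6 * 5 ^ 2 * (2 * (l : ℝ)) ^ 2 + 5 ^ 4 ≤ 0 := by nlinarith
      nlinarith
    · have h' : (49 : ℝ) ≤ (l : ℝ) ^ 2 := by exact_mod_cast h
      have e : 6000 ≤ (2 * (l : ℝ)) ^ 4 - 6 * 5 ^ 2 * (2 * (l : ℝ)) ^ 2 + 5 ^ 4 := by nlinarith
      nlinarith

/-- Here `modeProd` is negative for |l| ≤ 2. With c = 6000 only the terms l = ±2 can be negative,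
for small s, and the other five compensate: over a common denominator the numerator is a polynomial
in s² with nonnegative coefficients. -/
lemma sum_remainderTerm_nonneg_five (s : ℝ) :
    0 ≤ ∑ l ∈ Finset.Icc (-3 : ℤ) 3, remainderTerm 5 6000 l s := by
  have e : Finset.Icc (-3 : ℤ) 3 = {-3, -2, -1, 0, 1, 2, 3} := by decide
  have hsum : ∑ l ∈ Finset.Icc (-3 : ℤ) 3, remainderTerm 5 6000 l s =
      ((5375 * s ^ 2 + 3359375) / (25 * ((s ^ 2) ^ 2 + 1250 * s ^ 2 + 390625)) +
      2 * (4359 * s ^ 2 + 244319) / (21 * ((s ^ 2) ^ 2 + 1682 * s ^ 2 + 1681)) +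
      2 * (1119 * s ^ 2 - 11421361) / (9 * ((s ^ 2) ^ 2 + 3362 * s ^ 2 + 2307361)) +
      2 * (4921 * s ^ 2 + 32977441) / (11 * ((s ^ 2) ^ 2 + 7442 * s ^ 2 + 12103441))) *
        (s ^ 2 + 6000)⁻¹ := by
    have hD : ∀ n m k : ℝ, ((n ^ 2 + s ^ 2) * (m ^ 2 + s ^ 2)) * (s ^ 2 + k)
      = ((s ^ 2) ^ 2 + (n ^ 2 + m ^ 2) * s ^ 2 + n ^ 2 * m ^ 2) * (s ^ 2 + k) := by intros; ring
    have t : ∀ A N D X : ℝ, A⁻¹ * (N / (D * X)) = (N / (A * D)) * X⁻¹ := by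
      intros; simp only [div_eq_mul_inv, mul_inv]; ring
    rw [e]
    simp only [remainderTerm, remainderNum, modeProd, modeRate, hD, t]
    rw [Finset.sum_insert (by decide), Finset.sum_insert (by decide), Finset.sum_insert (by decide),
      Finset.sum_insert (by decide), Finset.sum_insert (by decide), Finset.sum_insert (by decide),
      Finset.sum_singleton]
    norm_num
    simp only [← add_mul]
    congr 1
    simp only [div_neg]
    ring
  rw [hsum]
  have hX := sq_nonneg s
  generalize s ^ 2 = X at *
  apply mul_nonneg _ (by positivity)
  rw [div_add_div _ _ (by positivity) (by positivity), div_add_div _ _ (by positivity) (by positivity),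
    div_add_div _ _ (by positivity) (by positivity)]
  apply div_nonneg _ (by positivity)
  ring_nf
  positivity

/-- For l ~ N and s² ≤ N⁴ the numerator is at least N⁸, while `modeProd` is of order N² and the
other three denominators are of order at most N⁴. The condition N ≥ 40 lets the leading powers
absorb h² ≤ 25 and c ≤ 6000. -/
lemma remainderTerm_lower {h : ℕ} (hh : h ≤ 5) {c : ℝ} (hc : 0 < c) (hc' : c ≤ 6000) {N : ℕ}
    (hN : 40 ≤ N) {l : ℤ} (hl : (N : ℤ) ≤ l) (hl' : l ≤ 2 * N) {s : ℝ} (hs : |s| ≤ (N : ℝ) ^ 2) :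
    1 / (64000000 * (N : ℝ) ^ 6) ≤ remainderTerm h c l s := by
  have hN' : (40 : ℝ) ≤ N := by exact_mod_cast hN
  have hl1 : (N : ℝ) ≤ l := by exact_mod_cast hl
  have hl2 : (l : ℝ) ≤ 2 * N := by exact_mod_cast hl'
  have hh' : (h : ℝ) ≤ 5 := by exact_mod_cast hh
  have hh0 : (0 : ℝ) ≤ h := Nat.cast_nonneg h
  have hsq : (h : ℝ) ^ 2 ≤ 25 := by nlinarith
  have hN2 : 1600 ≤ (N : ℝ) ^ 2 := by nlinarith
  have hN4 : 1600 * (N : ℝ) ^ 2 ≤ (N : ℝ) ^ 4 := by nlinarith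
  have hs2 : s ^ 2 ≤ (N : ℝ) ^ 4 := by
    rw [← sq_abs]
    calc |s| ^ 2 ≤ ((N : ℝ) ^ 2) ^ 2 := by gcongr
      _ = _ := by ring
  have hx1 : 4 * (N : ℝ) ^ 2 ≤ (2 * (l : ℝ)) ^ 2 := by nlinarith
  have hx2 : (2 * (l : ℝ)) ^ 2 ≤ 16 * (N : ℝ) ^ 2 := by nlinarith
  have hA1 : 3 * (N : ℝ) ^ 2 ≤ modeProd h l := by unfold modeProd; nlinarith
  have hA2 : modeProd h l ≤ 16 * (N : ℝ) ^ 2 := by unfold modeProd; nlinarith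
  have hrate : ∀ n : ℤ, (n : ℝ) ^ 2 ≤ 25 * (N : ℝ) ^ 2 →
      modeRate h n ^ 2 + s ^ 2 ≤ 1400 * (N : ℝ) ^ 4 := by
    intro n hn
    have h1 : modeRate h n ≤ 25 * (N : ℝ) ^ 2 := by unfold modeRate; nlinarith
    have h2 : -(25 * (N : ℝ) ^ 2) ≤ modeRate h n := by unfold modeRate; nlinarith [sq_nonneg (n : ℝ)]
    have h3 : modeRate h n ^ 2 ≤ (25 * (N : ℝ) ^ 2) ^ 2 := sq_le_sq' h2 h1
    nlinarith
  have hp := hrate (2 * l + h) (by push_cast; nlinarith)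
  have hq := hrate (2 * l - h) (by push_cast; nlinarith)
  have ha : 7 * (N : ℝ) ^ 4 ≤ modeRate h (2 * l + h) * modeRate h (2 * l - h) := by
    have e : modeRate h (2 * l + h) * modeRate h (2 * l - h) =
      modeProd h l ^ 2 - 4 * (h : ℝ) ^ 2 * (2 * (l : ℝ)) ^ 2 := by
      simp only [modeProd, modeRate]; push_cast; ring
    have h1 : (3 * (N : ℝ) ^ 2) ^ 2 ≤ modeProd h l ^ 2 := by gcongr
    have h2 : (h : ℝ) ^ 2 * (2 * (l : ℝ)) ^ 2 ≤ 25 * (16 * (N : ℝ) ^ 2) := by gcongr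
    rw [e]
    nlinarith
  have hnum : (N : ℝ) ^ 8 ≤ remainderNum h c l s := by
    unfold remainderNum
    set a := modeRate h (2 * l + h) * modeRate h (2 * l - h)
    have h1 : 0 ≤ s ^ 2 * (modeProd h l ^ 2 + 12 * (h : ℝ) ^ 2 * (2 * (l : ℝ)) ^ 2 - c) := by
      apply mul_nonneg (sq_nonneg s)
      have h1 : (3 * (N : ℝ) ^ 2) ^ 2 ≤ modeProd h l ^ 2 := by gcongr
      have : 0 ≤ 12 * (h : ℝ) ^ 2 * (2 * (l : ℝ)) ^ 2 := by positivity
      nlinarith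
    have h2 : (N : ℝ) ^ 4 ≤ a - c := by nlinarith
    have h3 : (N : ℝ) ^ 4 ≤ a := by nlinarith
    have h4 : (N : ℝ) ^ 4 * (N : ℝ) ^ 4 ≤ a * (a - c) := by gcongr; linarith [pow_pos (by linarith : (0 : ℝ) < N) 4]
    have h5 : (N : ℝ) ^ 8 = (N : ℝ) ^ 4 * (N : ℝ) ^ 4 := by ring
    linarith
  have hsc : s ^ 2 + c ≤ 2 * (N : ℝ) ^ 4 := by nlinarith
  have hN0 : (0 : ℝ) < N := by linarith
  have hA0 : 0 < modeProd h l := lt_of_lt_of_le (by positivity) hA1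
  have hnz : 0 < modeRate h (2 * l + h) * modeRate h (2 * l - h) := lt_of_lt_of_le (by positivity) ha
  have hpne : modeRate h (2 * l + h) ≠ 0 := left_ne_zero_of_mul hnz.ne'
  have hqne : modeRate h (2 * l - h) ≠ 0 := right_ne_zero_of_mul hnz.ne'
  have hnum0 : 0 ≤ remainderNum h c l s := le_trans (by positivity) hnum
  unfold remainderTerm
  -- The constant is 16 · 1400² · 2 = 62720000, rounded up.
  calc 1 / (64000000 * (N : ℝ) ^ 6) ≤ (16 * (N : ℝ) ^ 2)⁻¹ * ((N : ℝ) ^ 8 /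
      (((1400 * (N : ℝ) ^ 4) * (1400 * (N : ℝ) ^ 4)) * (2 * (N : ℝ) ^ 4))) := by
        rw [← sub_nonneg]
        have : (16 * (N : ℝ) ^ 2)⁻¹ * ((N : ℝ) ^ 8 /
          (((1400 * (N : ℝ) ^ 4) * (1400 * (N : ℝ) ^ 4)) * (2 * (N : ℝ) ^ 4))) =
            (1 / 62720000) * (1 / (N : ℝ) ^ 6) := by field_simp; norm_num
        rw [this]
        have : 1 / (64000000 * (N : ℝ) ^ 6) = (1 / 64000000) * (1 / (N : ℝ) ^ 6) := by field_simp
        rw [this, ← sub_mul]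
        positivity
    _ ≤ _ := by gcongr

lemma exists_kernel_le {h : ℕ} (hh : h = 1 ∨ h = 5) :
    ∃ κ : ℝ, 0 < κ ∧ ∀ s : ℝ, ∑' l, (modeProd h l)⁻¹ * modeInteraction h l s ≤
      -κ * (1 + s ^ 2) ^ (-(5 / 4) : ℝ) := by
  have hodd : Odd h := by rcases hh with rfl | rfl <;> decide
  obtain ⟨c, hc, hc', hfar, hnear⟩ : ∃ c : ℝ, 0 < c ∧ c ≤ 6000 ∧
      (∀ (l : ℤ) (s : ℝ), 4 ≤ |l| → 0 ≤ remainderTerm h c l s) ∧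
      (∀ s : ℝ, 0 ≤ ∑ l ∈ Finset.Icc (-3 : ℤ) 3, remainderTerm h c l s) := by
    rcases hh with rfl | rfl
    · refine ⟨1, one_pos, by norm_num, fun l s hl => remainderTerm_nonneg_of_one_le (by omega),
        fun s => Finset.sum_nonneg fun l _ => ?_⟩
      rcases eq_or_ne l 0 with rfl | hl
      · norm_num [remainderTerm, remainderNum, modeProd, modeRate]
      · exact remainderTerm_nonneg_of_one_le (Int.one_le_abs hl)
    · exact ⟨6000, by norm_num, le_rfl, fun l s hl => remainderTerm_nonneg_of_four_le hl,
        sum_remainderTerm_nonneg_five⟩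
  -- More than N terms of size N⁻⁶/64000000, together with N ≤ 41r where r = (1 + s²)^{1/4}.
  refine ⟨1 / (64000000 * 41 ^ 5), by positivity, fun s => ?_⟩
  set r : ℝ := (1 + s ^ 2) ^ (1 / 4 : ℝ) with hr
  have hb : 1 ≤ 1 + s ^ 2 := by nlinarith [sq_nonneg s]
  have hr1 : 1 ≤ r := Real.one_le_rpow hb (by norm_num)
  have hr4 : r ^ 4 = 1 + s ^ 2 := by
    rw [hr, ← Real.rpow_natCast, ← Real.rpow_mul (by positivity)]; norm_num
  have hr5 : (1 + s ^ 2) ^ (-(5 / 4) : ℝ) = (r ^ 5)⁻¹ := by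
    rw [hr, ← Real.rpow_natCast _ 5, ← Real.rpow_mul (by positivity), ← Real.rpow_neg (by positivity)]
    norm_num
  -- The shift 39 gives N ≥ 40, and r ≥ 1 gives N ≤ r + 40 ≤ 41r.
  set N : ℕ := ⌈r⌉₊ + 39 with hNdef
  have hNr : (N : ℝ) ≤ 41 * r := by
    have := (Nat.ceil_lt_add_one (by positivity : 0 ≤ r)).le
    rw [hNdef]; push_cast; linarith
  have hrN : r ≤ N := by
    have := Nat.le_ceil r
    rw [hNdef]; push_cast; linarith
  have hN40 : 40 ≤ N := by
    have : 0 < ⌈r⌉₊ := Nat.ceil_pos.2 (by linarith)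
    omega
  have hsN : |s| ≤ (N : ℝ) ^ 2 := by
    have h1 : |s| ≤ r ^ 2 := by
      apply abs_le_of_sq_le_sq _ (by positivity)
      nlinarith
    exact h1.trans (by gcongr)
  have hsum := hasSum_remainderTerm hodd hc s
  have hdisj : Disjoint (Finset.Icc (-3 : ℤ) 3) (Finset.Icc (N : ℤ) (2 * N)) := by
    rw [Finset.disjoint_left]
    intro x hx hx'
    simp only [Finset.mem_Icc] at hx hx'
    omega
  -- Keep the central block, nonnegative as a whole, and the block [N, 2N]. Every discarded term has
  -- |l| ≥ 4, hence is nonnegative.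
  have hle := hsum.summable.sum_le_tsum
    (Finset.Icc (-3 : ℤ) 3 ∪ Finset.Icc (N : ℤ) (2 * N)) (fun l hl => hfar l s (by
      simp only [Finset.mem_union, Finset.mem_Icc, not_or] at hl
      rcases abs_cases l with h | h <;> omega))
  rw [hsum.tsum_eq, Finset.sum_union hdisj] at hle
  have hlow : (N : ℝ) * (1 / (64000000 * (N : ℝ) ^ 6)) ≤
      ∑ l ∈ Finset.Icc (N : ℤ) (2 * N), remainderTerm h c l s := by
    have h5 : h ≤ 5 := by rcases hh with rfl | rfl <;> norm_num
    have h1 : ∀ l ∈ Finset.Icc (N : ℤ) (2 * N),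
        1 / (64000000 * (N : ℝ) ^ 6) ≤ remainderTerm h c l s := fun l hl => by
      rw [Finset.mem_Icc] at hl
      exact remainderTerm_lower h5 hc hc' hN40 hl.1 hl.2 hsN
    have h2 := Finset.card_nsmul_le_sum _ _ _ h1
    refine le_trans ?_ h2
    rw [nsmul_eq_mul, Int.card_Icc]
    gcongr
    omega
  have hN0 : (0 : ℝ) < N := by linarith
  have hfin : 1 / (64000000 * 41 ^ 5) * (r ^ 5)⁻¹ ≤ (N : ℝ) * (1 / (64000000 * (N : ℝ) ^ 6)) := by
    have e : (N : ℝ) * (1 / (64000000 * (N : ℝ) ^ 6)) = 1 / (64000000 * (N : ℝ) ^ 5) := by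
      field_simp
    rw [e, ← one_div, div_mul_div_comm, one_mul, mul_assoc, ← mul_pow]
    gcongr
  rw [hr5]
  have := hnear s
  linarith

/-! ### The Fourier transform on `L¹ ∩ L²` -/

lemma continuous_fourier_of_integrable {f : ℝ → ℂ} (h1 : Integrable f) : Continuous (𝓕 f) :=
  VectorFourier.fourierIntegral_continuous Real.continuous_fourierChar
    (by exact continuous_inner) h1

lemma norm_fourier_le_integral_norm (f : ℝ → ℂ) (ξ : ℝ) : ‖𝓕 f ξ‖ ≤ ∫ t, ‖f t‖ :=
  VectorFourier.norm_fourierIntegral_le_integral_norm _ _ _ f ξ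

lemma ae_eq_of_integral_schwartz_mul_eq {F G : ℝ → ℂ} (hF : LocallyIntegrable F)
    (hG : LocallyIntegrable G)
    (h : ∀ g : SchwartzMap ℝ ℂ, ∫ x, g x * F x = ∫ x, g x * G x) : F =ᵐ[volume] G := by
  apply ae_eq_of_integral_contDiff_smul_eq hF hG
  intro g g_smooth g_cpt
  have hg₁ : HasCompactSupport (Complex.ofRealCLM ∘ g) := g_cpt.comp_left rfl
  have hg₂ : ContDiff ℝ ∞ (Complex.ofRealCLM ∘ g) := by fun_prop
  simpa using h (hg₁.toSchwartzMap hg₂)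

/-- Both transforms induce the same tempered distribution: against a Schwartz function the transform
moves across, by compatibility on the L² side and by Fubini on the integral side. -/
lemma fourier_toLp_ae {f : ℝ → ℂ} (h1 : Integrable f) (h2 : MemLp f 2) :
    (𝓕 (h2.toLp f) : Lp ℂ 2 (volume : Measure ℝ)) =ᵐ[volume] 𝓕 f := by
  apply ae_eq_of_integral_schwartz_mul_eq
  · exact (Lp.memLp _).locallyIntegrable (by norm_num)
  · exact (continuous_fourier_of_integrable h1).locallyIntegrable
  intro g
  have h3 := congrArg (fun D : TemperedDistribution ℝ ℂ => D g)
    (Lp.fourier_toTemperedDistribution_eq (h2.toLp f))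
  simp only [TemperedDistribution.fourier_apply, Lp.toTemperedDistribution_apply, smul_eq_mul] at h3
  rw [← h3]
  have h4 : ∫ x, (𝓕 g) x * (h2.toLp f) x = ∫ x, 𝓕 (g : ℝ → ℂ) x * f x := by
    apply integral_congr_ae
    filter_upwards [h2.coeFn_toLp] with x hx
    rw [hx, SchwartzMap.fourier_coe]
  rw [h4]
  have := VectorFourier.integral_fourierIntegral_smul_eq_flip (L := innerₗ ℝ) (μ := volume)
    (ν := volume) Real.continuous_fourierChar continuous_inner g.integrable h1
  simpa using! this

lemma fourierInv_toLp_ae {f : ℝ → ℂ} (h1 : Integrable f) (h2 : MemLp f 2) :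
    (𝓕⁻ (h2.toLp f) : Lp ℂ 2 (volume : Measure ℝ)) =ᵐ[volume] 𝓕⁻ f := by
  have hc : Continuous (𝓕⁻ f) := by
    have := (continuous_fourier_of_integrable h1).comp continuous_neg
    convert this using 1
    ext x
    simp [Real.fourierInv_eq_fourier_neg]
  apply ae_eq_of_integral_schwartz_mul_eq
  · exact (Lp.memLp _).locallyIntegrable (by norm_num)
  · exact hc.locallyIntegrable
  intro g
  have h3 := congrArg (fun D : TemperedDistribution ℝ ℂ => D g)
    (Lp.fourierInv_toTemperedDistribution_eq (h2.toLp f))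
  simp only [TemperedDistribution.fourierInv_apply, Lp.toTemperedDistribution_apply,
    smul_eq_mul] at h3
  rw [← h3]
  have h4 : ∫ x, (𝓕⁻ g) x * (h2.toLp f) x = ∫ x, 𝓕⁻ (g : ℝ → ℂ) x * f x := by
    apply integral_congr_ae
    filter_upwards [h2.coeFn_toLp] with x hx
    rw [hx, SchwartzMap.fourierInv_coe]
  rw [h4]
  have := VectorFourier.integral_fourierIntegral_smul_eq_flip (L := -innerₗ ℝ) (μ := volume)
    (ν := volume) Real.continuous_fourierChar (by simp; fun_prop) g.integrable h1
  simp only [smul_eq_mul] at this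
  have e : ∀ k : ℝ → ℂ, 𝓕⁻ k = VectorFourier.fourierIntegral Real.fourierChar volume (-innerₗ ℝ) k := by
    intro k; ext x; simp [Real.fourierInv_eq, VectorFourier.fourierIntegral]
  have e' : ∀ k : ℝ → ℂ, 𝓕⁻ k = VectorFourier.fourierIntegral Real.fourierChar volume
      (-innerₗ ℝ).flip k := by
    intro k; ext x; simp [Real.fourierInv_eq, VectorFourier.fourierIntegral, mul_comm]
  rw [e g, e' f]
  exact this

lemma integral_conj_fourier_mul_fourier {f g : ℝ → ℂ} (hf : Integrable f) (hf2 : MemLp f 2)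
    (hg : Integrable g) (hg2 : MemLp g 2) :
    ∫ ξ, (starRingEnd ℂ) (𝓕 f ξ) * 𝓕 g ξ = ∫ t, (starRingEnd ℂ) (f t) * g t := by
  have h := Lp.inner_fourier_eq (hf2.toLp f) (hg2.toLp g)
  simp only [L2.inner_def] at h
  have h1 : ∫ ξ, (starRingEnd ℂ) (𝓕 f ξ) * 𝓕 g ξ =
      ∫ ξ, inner ℂ ((𝓕 (hf2.toLp f) : Lp ℂ 2 (volume : Measure ℝ)) ξ)
        ((𝓕 (hg2.toLp g) : Lp ℂ 2 (volume : Measure ℝ)) ξ) := by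
    apply integral_congr_ae
    filter_upwards [fourier_toLp_ae hf hf2, fourier_toLp_ae hg hg2] with x hx hy
    rw [hx, hy, RCLike.inner_apply, mul_comm]
  rw [h1, h]
  apply integral_congr_ae
  filter_upwards [hf2.coeFn_toLp, hg2.coeFn_toLp] with x hx hy
  rw [hx, hy, RCLike.inner_apply, mul_comm]

/-! ### Duality between `H^{5/4}` and `H^{-5/4}` -/

/-- The weight of `H^{5/4}(ℝ)`. -/
def sobolevWeight (ξ : ℝ) : ℝ := (1 + (2 * Real.pi * ξ) ^ 2) ^ (5 / 4 : ℝ)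

lemma sobolevWeight_pos (ξ : ℝ) : 0 < sobolevWeight ξ := by unfold sobolevWeight; positivity

lemma continuous_sobolevWeight : Continuous sobolevWeight := by
  unfold sobolevWeight
  refine Continuous.rpow_const (by fun_prop) fun x => Or.inr (by norm_num)

lemma sobolevWeight_neg (ξ : ℝ) : sobolevWeight (-ξ) = sobolevWeight ξ := by
  simp [sobolevWeight]

/-- The square of the norm of `a`, seen as the Fourier transform of an element of
`H^{-5/4}(ℝ)`. -/
def dualEnergy (a : ℝ → ℂ) : ℝ≥0∞ :=
  ∫⁻ ξ, ENNReal.ofReal (sobolevWeight ξ)⁻¹ * ‖a ξ‖ₑ ^ 2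

/-- Cauchy–Schwarz after inserting 1 = w⁻¹ · w with w the square root of the weight. -/
lemma lintegral_mul_le_weighted {a f : ℝ → ℂ} (ha : AEStronglyMeasurable a)
    (hf : AEStronglyMeasurable f) :
    ∫⁻ ξ, ‖a ξ‖ₑ * ‖f ξ‖ₑ ≤ dualEnergy a ^ (1 / 2 : ℝ) *
      (∫⁻ ξ, ENNReal.ofReal (sobolevWeight ξ) * ‖f ξ‖ₑ ^ 2) ^ (1 / 2 : ℝ) := by
  set w : ℝ → ℝ≥0∞ := fun ξ => ENNReal.ofReal (Real.sqrt (sobolevWeight ξ)) with hw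
  have hwc : Measurable w :=
    (Real.continuous_sqrt.comp continuous_sobolevWeight).measurable.ennreal_ofReal
  have hw0 : ∀ ξ, w ξ ≠ 0 := fun ξ => by
    simp only [hw, ne_eq, ENNReal.ofReal_eq_zero, not_le]
    exact Real.sqrt_pos.2 (sobolevWeight_pos ξ)
  have hwt : ∀ ξ, w ξ ≠ ⊤ := fun ξ => ENNReal.ofReal_ne_top
  have hsq : ∀ ξ, w ξ ^ 2 = ENNReal.ofReal (sobolevWeight ξ) := fun ξ => by
    rw [hw, ← ENNReal.ofReal_pow (Real.sqrt_nonneg _), Real.sq_sqrt (sobolevWeight_pos ξ).le]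
  have h := ENNReal.lintegral_mul_le_Lp_mul_Lq (volume : Measure ℝ) Real.HolderConjugate.two_two
    (f := fun ξ => (w ξ)⁻¹ * ‖a ξ‖ₑ) (g := fun ξ => w ξ * ‖f ξ‖ₑ)
    (hwc.inv.aemeasurable.mul ha.enorm) (hwc.aemeasurable.mul hf.enorm)
  have e1 : ∀ ξ, ((fun ξ => (w ξ)⁻¹ * ‖a ξ‖ₑ) * fun ξ => w ξ * ‖f ξ‖ₑ) ξ = ‖a ξ‖ₑ * ‖f ξ‖ₑ := by
    intro ξ
    simp only [Pi.mul_apply]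
    rw [mul_mul_mul_comm, ENNReal.inv_mul_cancel (hw0 ξ) (hwt ξ), one_mul]
  simp only [e1] at h
  refine h.trans (le_of_eq ?_)
  unfold dualEnergy
  congr 2 <;> refine lintegral_congr fun ξ => ?_
  · rw [ENNReal.rpow_two, mul_pow, ← ENNReal.inv_pow, hsq, ENNReal.ofReal_inv_of_pos
      (sobolevWeight_pos ξ)]
  · rw [ENNReal.rpow_two, mul_pow, hsq]

/-- This is where 5/4 > 1/2 enters. It yields both the embedding of H^{5/4} into continuous
functions and the finite energy of bounded transforms. -/
lemma integrable_inv_sobolevWeight : Integrable fun ξ => (sobolevWeight ξ)⁻¹ := by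
  have h := integrable_rpow_neg_one_add_norm_sq (E := ℝ) (μ := volume) (r := 5 / 2)
    (by simp; norm_num)
  refine h.mono' (continuous_sobolevWeight.inv₀ fun ξ => (sobolevWeight_pos ξ).ne').aestronglyMeasurable
    (Filter.Eventually.of_forall fun ξ => ?_)
  rw [Real.norm_of_nonneg (inv_nonneg.2 (sobolevWeight_pos ξ).le), sobolevWeight,
    ← Real.rpow_neg (by positivity)]
  rw [show -(5 / 2 : ℝ) / 2 = -(5 / 4) by norm_num]
  apply Real.rpow_le_rpow_of_nonpos (by positivity) _ (by norm_num)
  rw [Real.norm_eq_abs, sq_abs, mul_pow]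
  have : 1 ≤ (2 * Real.pi) ^ 2 := by nlinarith [Real.pi_gt_three]
  nlinarith [sq_nonneg ξ]

lemma dualEnergy_lt_top_of_bounded {a : ℝ → ℂ} {M : ℝ} (h : ∀ ξ, ‖a ξ‖ ≤ M) :
    dualEnergy a < ⊤ := by
  have h1 : ∫⁻ ξ, ENNReal.ofReal (sobolevWeight ξ)⁻¹ < ⊤ :=
    integrable_inv_sobolevWeight.lintegral_lt_top
  calc dualEnergy a ≤ ∫⁻ ξ, ENNReal.ofReal (sobolevWeight ξ)⁻¹ * ENNReal.ofReal M ^ 2 := by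
        refine lintegral_mono fun ξ => ?_
        gcongr
        rw [← ofReal_norm]
        exact ENNReal.ofReal_le_ofReal (h ξ)
    _ = (∫⁻ ξ, ENNReal.ofReal (sobolevWeight ξ)⁻¹) * ENNReal.ofReal M ^ 2 :=
        lintegral_mul_const' _ _ (by simp)
    _ < ⊤ := ENNReal.mul_lt_top h1 (by simp)

lemma sobolevNorm_eq (Φ : Lp ℂ 2 (volume : Measure ℝ)) :
    sobolevNorm (5 / 4) Φ = (∫⁻ ξ, ENNReal.ofReal (sobolevWeight ξ) *
      ‖(𝓕 Φ : Lp ℂ 2 (volume : Measure ℝ)) ξ‖ₑ ^ 2) ^ (1 / 2 : ℝ) := rfl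

lemma integrable_fourier_of_sobolevNorm_lt_top {Φ : Lp ℂ 2 (volume : Measure ℝ)}
    (h : sobolevNorm (5 / 4) Φ < ⊤) :
    Integrable (𝓕 Φ : Lp ℂ 2 (volume : Measure ℝ)) := by
  refine ⟨Lp.aestronglyMeasurable _, ?_⟩
  have h1 := lintegral_mul_le_weighted (a := fun _ => 1) (f := (𝓕 Φ : Lp ℂ 2 (volume : Measure ℝ)))
    aestronglyMeasurable_const (Lp.aestronglyMeasurable _)
  simp only [enorm_one, one_mul] at h1
  refine h1.trans_lt (ENNReal.mul_lt_top ?_ h)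
  exact ENNReal.rpow_lt_top_of_nonneg (by norm_num)
    (dualEnergy_lt_top_of_bounded (M := 1) (by simp)).ne

lemma ae_eq_fourierInv_of_sobolevNorm_lt_top {Φ : Lp ℂ 2 (volume : Measure ℝ)}
    (h : sobolevNorm (5 / 4) Φ < ⊤) :
    Φ =ᵐ[volume] 𝓕⁻ ((𝓕 Φ : Lp ℂ 2 (volume : Measure ℝ)) : ℝ → ℂ) := by
  have h1 := fourierInv_toLp_ae (integrable_fourier_of_sobolevNorm_lt_top h)
    (Lp.memLp (𝓕 Φ : Lp ℂ 2 (volume : Measure ℝ)))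
  rw [Lp.toLp_coeFn, FourierTransform.fourierInv_fourier_eq] at h1
  exact h1

lemma integral_mul_fourierInv {f g : ℝ → ℂ} (hf : Integrable f) (hg : Integrable g) :
    ∫ t, f t * 𝓕⁻ g t = ∫ ξ, 𝓕⁻ f ξ * g ξ := by
  have := VectorFourier.integral_fourierIntegral_smul_eq_flip (L := -innerₗ ℝ) (μ := volume)
    (ν := volume) Real.continuous_fourierChar (by simp; fun_prop) hf hg
  simp only [smul_eq_mul] at this
  have e : ∀ k : ℝ → ℂ, 𝓕⁻ k = VectorFourier.fourierIntegral Real.fourierChar volume (-innerₗ ℝ) k := by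
    intro k; ext x; simp [Real.fourierInv_eq, VectorFourier.fourierIntegral]
  have e' : ∀ k : ℝ → ℂ, 𝓕⁻ k = VectorFourier.fourierIntegral Real.fourierChar volume
      (-innerₗ ℝ).flip k := by
    intro k; ext x; simp [Real.fourierInv_eq, VectorFourier.fourierIntegral, mul_comm]
  rw [e f, e' g]
  exact this.symm

lemma continuous_fourierInv_of_integrable {f : ℝ → ℂ} (h1 : Integrable f) : Continuous (𝓕⁻ f) := by
  have := (continuous_fourier_of_integrable h1).comp continuous_neg
  convert this using 1
  ext x
  simp [Real.fourierInv_eq_fourier_neg]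

lemma dualEnergy_fourierInv (f : ℝ → ℂ) : dualEnergy (𝓕⁻ f) = dualEnergy (𝓕 f) := by
  unfold dualEnergy
  rw [← lintegral_neg_eq_self]
  refine lintegral_congr fun ξ => ?_
  rw [Real.fourierInv_eq_fourier_neg, sobolevWeight_neg, neg_neg]

/-- As u lives on [0,T], φ may be replaced by its extension Φ = 𝓕⁻(𝓕 Φ). Moving 𝓕⁻ onto u leaves a
pairing to which weighted Cauchy–Schwarz applies. -/
lemma enorm_integral_mul_le {T : ℝ} {u : ℝ → ℝ} (hu : Integrable u)
    (hsupp : ∀ᵐ t : ℝ, t ∉ Icc 0 T → u t = 0) {φ : ℝ → ℂ} (Φ : Lp ℂ 2 (volume : Measure ℝ))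
    (hΦ : ∀ᵐ t ∂(volume.restrict (Ioo 0 T)), Φ t = φ t) (hfin : sobolevNorm (5 / 4) Φ < ⊤) :
    ‖∫ t in Ioo 0 T, (u t : ℂ) * φ t‖ₑ ≤
      dualEnergy (𝓕 fun t => (u t : ℂ)) ^ (1 / 2 : ℝ) * sobolevNorm (5 / 4) Φ := by
  set f : ℝ → ℂ := ⇑(𝓕 Φ : Lp ℂ 2 (volume : Measure ℝ)) with hf
  have hfi : Integrable f := integrable_fourier_of_sobolevNorm_lt_top hfin
  have hui : Integrable fun t => (u t : ℂ) := hu.ofReal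
  have h1 : ∫ t in Ioo 0 T, (u t : ℂ) * φ t = ∫ t in Icc 0 T, (u t : ℂ) * Φ t := by
    rw [integral_Icc_eq_integral_Ioo]
    apply integral_congr_ae
    filter_upwards [hΦ] with t ht
    rw [ht]
  have h2 : ∫ t in Icc 0 T, (u t : ℂ) * Φ t = ∫ t, (u t : ℂ) * 𝓕⁻ f t := by
    rw [setIntegral_eq_integral_of_ae_compl_eq_zero]
    · apply integral_congr_ae
      filter_upwards [ae_eq_fourierInv_of_sobolevNorm_lt_top hfin] with t ht
      rw [ht]
    · filter_upwards [hsupp] with t ht htn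
      simp [ht htn]
  rw [h1, h2, integral_mul_fourierInv hui hfi, sobolevNorm_eq, ← dualEnergy_fourierInv]
  refine (enorm_integral_le_lintegral_enorm _).trans ?_
  simp only [enorm_mul]
  exact lintegral_mul_le_weighted (continuous_fourierInv_of_integrable hui).aestronglyMeasurable
    (Lp.aestronglyMeasurable _)

lemma dualSobolevNorm_le {T : ℝ} {u : ℝ → ℝ} (hu : Integrable u)
    (hsupp : ∀ᵐ t : ℝ, t ∉ Icc 0 T → u t = 0) :
    dualSobolevNorm (5 / 4) (Ioo 0 T) u ≤ dualEnergy (𝓕 fun t => (u t : ℂ)) ^ (1 / 2 : ℝ) := by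
  unfold dualSobolevNorm
  refine iSup₂_le fun φ hφ => ?_
  set D := dualEnergy (𝓕 fun t => (u t : ℂ)) ^ (1 / 2 : ℝ)
  have hD : D ≠ ⊤ := (ENNReal.rpow_lt_top_of_nonneg (by norm_num)
    (dualEnergy_lt_top_of_bounded (norm_fourier_le_integral_norm _)).ne).ne
  -- The quotient norm is an infimum, so an extension is only available with norm below a given r >
  -- 1. Then r tends to 1.
  have key : ∀ r : ℝ≥0∞, 1 < r → r < ⊤ → ‖∫ t in Ioo 0 T, (u t : ℂ) * φ t‖ₑ ≤ D * r := by
    intro r hr hrt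
    have h1 : sobolevNormOn (5 / 4) (Ioo 0 T) φ < r := hφ.trans_lt hr
    simp only [sobolevNormOn, iInf_lt_iff] at h1
    obtain ⟨Φ, hΦ, hlt⟩ := h1
    refine (enorm_integral_mul_le hu hsupp Φ hΦ (hlt.trans hrt)).trans ?_
    gcongr
  have h2 : Filter.Tendsto (fun r => D * r) (nhdsWithin 1 (Ioi 1)) (nhds (D * 1)) :=
    (ENNReal.Tendsto.const_mul Filter.tendsto_id (Or.inr hD)).mono_left nhdsWithin_le_nhds
  rw [mul_one] at h2
  refine ge_of_tendsto h2 ?_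
  have : Ioo (1 : ℝ≥0∞) ⊤ ∈ nhdsWithin (1 : ℝ≥0∞) (Ioi 1) := Ioo_mem_nhdsGT (by simp)
  filter_upwards [this] with r hr
  exact key r hr.1 hr.2

/-! ### Multiplication by Schwartz functions in `H^{-5/4}` -/

/-- Write g = 𝓕⁻(𝓕 g) and move the inverse transform onto v modulated by the frequency ξ. -/
lemma fourier_mul_schwartz {v : ℝ → ℂ} (hv : Integrable v) (g : SchwartzMap ℝ ℂ) (ξ : ℝ) :
    𝓕 (fun t => v t * g t) ξ = ∫ η, 𝓕 v (ξ - η) * 𝓕 (g : ℝ → ℂ) η := by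
  have hG : Integrable (𝓕 (g : ℝ → ℂ)) := by
    rw [← SchwartzMap.fourier_coe]; exact (𝓕 g).integrable
  have hg : 𝓕⁻ (𝓕 (g : ℝ → ℂ)) = g :=
    g.continuous.fourierInv_fourier_eq g.integrable hG
  set f : ℝ → ℂ := fun t => Real.fourierChar (-(t * ξ)) • v t with hf
  have hfi : Integrable f := (Real.fourierIntegral_convergent_iff (V := ℝ) ξ).2 hv |>.congr
    (by filter_upwards with t; simp [hf, mul_comm])
  have h1 := integral_mul_fourierInv hfi hG
  rw [hg] at h1
  have h2 : 𝓕 (fun t => v t * g t) ξ = ∫ t, f t * g t := by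
    rw [Real.fourier_eq']
    refine integral_congr_ae (Filter.Eventually.of_forall fun t => ?_)
    simp only [hf, Circle.smul_def, Real.fourierChar_apply, smul_eq_mul]
    rw [mul_assoc (Complex.exp _)]
    congr 2
    simp
    ring
  rw [h2, h1]
  refine integral_congr_ae (Filter.Eventually.of_forall fun η => ?_)
  simp only
  congr 1
  rw [Real.fourierInv_eq', Real.fourier_eq']
  refine integral_congr_ae (Filter.Eventually.of_forall fun t => ?_)
  simp only [hf, Circle.smul_def, Real.fourierChar_apply, smul_eq_mul]
  rw [← mul_assoc, ← Complex.exp_add]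
  congr 2
  simp
  ring

/-- Peetre's inequality: 1 + (a - b)² ≤ 2(1 + a²)(1 + b²), raised to the power 5/4. -/
lemma inv_sobolevWeight_le (ξ η : ℝ) :
    (sobolevWeight ξ)⁻¹ ≤ 2 ^ (5 / 4 : ℝ) * sobolevWeight η * (sobolevWeight (ξ - η))⁻¹ := by
  rw [inv_le_iff_one_le_mul₀ (sobolevWeight_pos ξ), mul_assoc, mul_assoc, mul_comm _ (sobolevWeight ξ),
    ← mul_assoc, ← mul_assoc, le_mul_inv_iff₀ (sobolevWeight_pos _), one_mul]
  unfold sobolevWeight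
  rw [← Real.mul_rpow (by positivity) (by positivity), ← Real.mul_rpow (by positivity) (by positivity)]
  apply Real.rpow_le_rpow (by positivity) _ (by norm_num)
  nlinarith [sq_nonneg (2 * Real.pi * ξ + 2 * Real.pi * η),
    mul_nonneg (sq_nonneg (2 * Real.pi * ξ)) (sq_nonneg (2 * Real.pi * η))]

lemma lintegral_enorm_fourier_mul_sobolevWeight_lt_top (g : SchwartzMap ℝ ℂ) :
    ∫⁻ η, ENNReal.ofReal (sobolevWeight η) * ‖𝓕 (g : ℝ → ℂ) η‖ₑ < ⊤ := by
  rw [← SchwartzMap.fourier_coe]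
  set G := 𝓕 g
  have h0 := G.integrable_pow_mul volume 0
  have h2 := G.integrable_pow_mul volume 2
  have h4 := G.integrable_pow_mul volume 4
  have hi := (h0.add (h2.const_mul (2 * (2 * Real.pi) ^ 2))).add (h4.const_mul ((2 * Real.pi) ^ 4))
  refine lt_of_le_of_lt (lintegral_mono fun η => ?_) hi.lintegral_lt_top
  rw [← ofReal_norm, ← ENNReal.ofReal_mul (sobolevWeight_pos η).le]
  apply ENNReal.ofReal_le_ofReal
  have hw : sobolevWeight η ≤ (1 + (2 * Real.pi * η) ^ 2) ^ 2 := by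
    unfold sobolevWeight
    rw [← Real.rpow_natCast (1 + _) 2]
    apply Real.rpow_le_rpow_of_exponent_le
    · nlinarith [sq_nonneg (2 * Real.pi * η)]
    · norm_num
  refine (mul_le_mul_of_nonneg_right hw (norm_nonneg _)).trans (le_of_eq ?_)
  simp only [Pi.add_apply, Real.norm_eq_abs, sq_abs, pow_zero]
  rw [show |η| ^ 4 = (|η| ^ 2) ^ 2 by ring, sq_abs]
  ring

lemma lintegral_mul_sq_le {a b : ℝ → ℝ≥0∞} (ha : Measurable a) (hb : Measurable b) :
    (∫⁻ η, b η * a η) ^ 2 ≤ (∫⁻ η, a η) * ∫⁻ η, b η ^ 2 * a η := by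
  have h := ENNReal.lintegral_mul_le_Lp_mul_Lq (volume : Measure ℝ) Real.HolderConjugate.two_two
    (f := fun η => a η ^ (1 / 2 : ℝ)) (g := fun η => b η * a η ^ (1 / 2 : ℝ))
    (ha.pow_const _).aemeasurable (hb.mul (ha.pow_const _)).aemeasurable
  have e : ∀ η, a η ^ (1 / 2 : ℝ) * a η ^ (1 / 2 : ℝ) = a η := fun η => by
    rw [← sq, ← ENNReal.rpow_natCast, ← ENNReal.rpow_mul]; norm_num
  have e1 : ∀ η, ((fun η => a η ^ (1 / 2 : ℝ)) * fun η => b η * a η ^ (1 / 2 : ℝ)) η = b η * a η := by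
    intro η
    simp only [Pi.mul_apply]
    rw [mul_left_comm, e]
  have e2 : ∀ η, (a η ^ (1 / 2 : ℝ)) ^ (2 : ℝ) = a η := fun η => by
    rw [ENNReal.rpow_two, sq, e]
  have e3 : ∀ η, (b η * a η ^ (1 / 2 : ℝ)) ^ (2 : ℝ) = b η ^ 2 * a η := fun η => by
    rw [ENNReal.rpow_two, mul_pow, sq (a η ^ (1 / 2 : ℝ)), e]
  simp only [e1, e2, e3] at h
  have e4 : ∀ x : ℝ≥0∞, (x ^ (1 / 2 : ℝ)) ^ 2 = x := fun x => by
    rw [← ENNReal.rpow_natCast, ← ENNReal.rpow_mul]; norm_num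
  calc _ ≤ ((∫⁻ η, a η) ^ (1 / 2 : ℝ) * (∫⁻ η, b η ^ 2 * a η) ^ (1 / 2 : ℝ)) ^ 2 := by gcongr
    _ = _ := by rw [mul_pow, e4, e4]

/-- The product becomes a convolution with ĝ. Cauchy–Schwarz for the measure |ĝ| dη, Peetre's
inequality and Tonelli bound its energy, since ĝ and its product with the weight are integrable. -/
lemma exists_dualEnergy_mul_schwartz_le (g : SchwartzMap ℝ ℂ) :
    ∃ C : ℝ≥0∞, C < ⊤ ∧ ∀ v : ℝ → ℂ, Integrable v →
      dualEnergy (𝓕 fun t => v t * g t) ≤ C * dualEnergy (𝓕 v) := by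
  have hGc : Continuous (𝓕 (g : ℝ → ℂ)) := continuous_fourier_of_integrable g.integrable
  have hGi : Integrable (𝓕 (g : ℝ → ℂ)) := by
    rw [← SchwartzMap.fourier_coe]; exact (𝓕 g).integrable
  set a : ℝ → ℝ≥0∞ := fun η => ‖𝓕 (g : ℝ → ℂ) η‖ₑ with ha
  have ham : Measurable a := hGc.measurable.enorm
  set L := ∫⁻ η, a η with hL
  have hLt : L < ⊤ := hGi.2
  set M := ∫⁻ η, ENNReal.ofReal (sobolevWeight η) * a η with hM
  have hMt : M < ⊤ := lintegral_enorm_fourier_mul_sobolevWeight_lt_top g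
  set c₀ : ℝ≥0∞ := ENNReal.ofReal (2 ^ (5 / 4 : ℝ)) with hc₀
  refine ⟨L * (c₀ * M), ENNReal.mul_lt_top hLt (ENNReal.mul_lt_top ENNReal.ofReal_lt_top hMt), ?_⟩
  intro v hv
  set V : ℝ → ℝ≥0∞ := fun ξ => ‖𝓕 v ξ‖ₑ with hV
  have hVm : Measurable V := (continuous_fourier_of_integrable hv).measurable.enorm
  set W : ℝ → ℝ≥0∞ := fun ξ => ENNReal.ofReal (sobolevWeight ξ)⁻¹ with hW
  have hWm : Measurable W :=
    (continuous_sobolevWeight.inv₀ fun ξ => (sobolevWeight_pos ξ).ne').measurable.ennreal_ofReal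
  have hwm : Measurable fun ξ => ENNReal.ofReal (sobolevWeight ξ) :=
    continuous_sobolevWeight.measurable.ennreal_ofReal
  have h1 : ∀ ξ, ‖𝓕 (fun t => v t * g t) ξ‖ₑ ^ 2 ≤ L * ∫⁻ η, V (ξ - η) ^ 2 * a η := by
    intro ξ
    have h2 : ‖𝓕 (fun t => v t * g t) ξ‖ₑ ≤ ∫⁻ η, V (ξ - η) * a η := by
      rw [fourier_mul_schwartz hv g ξ]
      refine (enorm_integral_le_lintegral_enorm _).trans (le_of_eq ?_)
      simp only [enorm_mul, ha, hV]
    calc _ ≤ (∫⁻ η, V (ξ - η) * a η) ^ 2 := by gcongr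
      _ ≤ _ := lintegral_mul_sq_le ham (hVm.comp (measurable_const.sub measurable_id))
  have h2 : ∀ ξ η, W ξ ≤ c₀ * ENNReal.ofReal (sobolevWeight η) * W (ξ - η) := by
    intro ξ η
    simp only [hW, hc₀]
    rw [← ENNReal.ofReal_mul (by positivity), ← ENNReal.ofReal_mul
      (mul_nonneg (by positivity) (sobolevWeight_pos η).le)]
    exact ENNReal.ofReal_le_ofReal (inv_sobolevWeight_le ξ η)
  have hmeas : Measurable (Function.uncurry fun ξ η : ℝ =>
      (c₀ * ENNReal.ofReal (sobolevWeight η) * a η) * (W (ξ - η) * V (ξ - η) ^ 2)) := by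
    have hs : Measurable fun p : ℝ × ℝ => p.1 - p.2 := measurable_fst.sub measurable_snd
    exact (((hwm.comp measurable_snd).const_mul c₀).mul (ham.comp measurable_snd)).mul
      ((hWm.comp hs).mul ((hVm.comp hs).pow_const 2))
  calc dualEnergy (𝓕 fun t => v t * g t)
      ≤ ∫⁻ ξ, W ξ * (L * ∫⁻ η, V (ξ - η) ^ 2 * a η) := by
        refine lintegral_mono fun ξ => ?_
        gcongr
        exact h1 ξ
    _ = L * ∫⁻ ξ, ∫⁻ η, W ξ * (V (ξ - η) ^ 2 * a η) := by
        rw [← lintegral_const_mul' _ _ hLt.ne]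
        refine lintegral_congr fun ξ => ?_
        rw [lintegral_const_mul' _ _ ENNReal.ofReal_ne_top]
        ring
    _ ≤ L * ∫⁻ ξ, ∫⁻ η, (c₀ * ENNReal.ofReal (sobolevWeight η) * a η) *
          (W (ξ - η) * V (ξ - η) ^ 2) := by
        refine mul_le_mul_right (lintegral_mono fun ξ => lintegral_mono fun η => ?_) _
        calc _ ≤ (c₀ * ENNReal.ofReal (sobolevWeight η) * W (ξ - η)) * (V (ξ - η) ^ 2 * a η) := by
              exact mul_le_mul_left (h2 ξ η) _
          _ = _ := by ring
    _ = L * ∫⁻ η, ∫⁻ ξ, (c₀ * ENNReal.ofReal (sobolevWeight η) * a η) *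
          (W (ξ - η) * V (ξ - η) ^ 2) := by
        rw [lintegral_lintegral_swap hmeas.aemeasurable]
    _ = L * ∫⁻ η, (c₀ * ENNReal.ofReal (sobolevWeight η) * a η) * dualEnergy (𝓕 v) := by
        congr 1
        refine lintegral_congr fun η => ?_
        rw [lintegral_const_mul' _ _ (ENNReal.mul_ne_top (ENNReal.mul_ne_top ENNReal.ofReal_ne_top
          ENNReal.ofReal_ne_top) (by simp [ha])),
          lintegral_sub_right_eq_self (fun ξ => W ξ * V ξ ^ 2) η]
        rfl
    _ = L * (c₀ * M) * dualEnergy (𝓕 v) := by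
        rw [lintegral_mul_const (f := fun η => c₀ * ENNReal.ofReal (sobolevWeight η) * a η) _
          ((hwm.const_mul c₀).mul ham), hM, mul_assoc L]
        congr 2
        simp only [mul_assoc]
        rw [lintegral_const_mul' _ _ ENNReal.ofReal_ne_top]

/-- The norm in `H^{-5/4}(ℝ)` of functions supported in `[0,T]` is stable under multiplication by
an exponential. -/
lemma exists_dualEnergy_exp_mul_le (T c : ℝ) :
    ∃ C : ℝ≥0∞, C < ⊤ ∧ ∀ v : ℝ → ℂ, Integrable v → (∀ᵐ t : ℝ, t ∉ Icc 0 T → v t = 0) →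
      dualEnergy (𝓕 fun t => v t * Complex.exp (c * t)) ≤ C * dualEnergy (𝓕 v) := by
  -- The cutoff equals 1 on a ball containing [0,T], so it makes the exponential a Schwartz function
  -- without changing the product with v.
  let χ : ContDiffBump (0 : ℝ) := ⟨|T| + 1, |T| + 2, by positivity, by linarith⟩
  have hsm : ContDiff ℝ ∞ fun t : ℝ => ((χ t : ℝ) : ℂ) * Complex.exp (c * t) := by
    have h1 : ContDiff ℝ ∞ fun t : ℝ => ((χ t : ℝ) : ℂ) :=
      Complex.ofRealCLM.contDiff.comp χ.contDiff
    have h2 : ContDiff ℝ ∞ fun t : ℝ => Complex.exp (c * t) :=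
      (contDiff_const.mul Complex.ofRealCLM.contDiff).cexp
    exact h1.mul h2
  have hcs : HasCompactSupport fun t : ℝ => ((χ t : ℝ) : ℂ) * Complex.exp (c * t) :=
    (χ.hasCompactSupport.comp_left (g := fun x : ℝ => (x : ℂ)) (by simp)).mul_right
  obtain ⟨C, hC, h⟩ := exists_dualEnergy_mul_schwartz_le (hcs.toSchwartzMap hsm)
  refine ⟨C, hC, fun v hv hsupp => ?_⟩
  have e : 𝓕 (fun t : ℝ => v t * Complex.exp (c * t)) =
      𝓕 fun t => v t * (hcs.toSchwartzMap hsm) t := by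
    refine VectorFourier.fourierIntegral_congr_ae _ _ _ ?_
    filter_upwards [hsupp] with t ht
    by_cases htI : t ∈ Icc 0 T
    · have : χ t = 1 := by
        apply χ.one_of_mem_closedBall
        rw [mem_closedBall_zero_iff, Real.norm_eq_abs, abs_of_nonneg htI.1]
        exact htI.2.trans ((le_abs_self T).trans (by simp [χ]))
      simp [this]
    · simp [ht htI]
  rw [e]
  exact h v hv

/-! ### Response of a single mode -/

/-- The solution on `(0,T]` of `w' + r w = v`, `w(0) = 0`, extended by `0`. -/
def modeResponse (T r : ℝ) (v : ℝ → ℝ) : ℝ → ℝ :=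
  (Ioc 0 T).indicator fun t => Real.exp (-(r * t)) * ∫ s in (0 : ℝ)..t, Real.exp (r * s) * v s

lemma intervalIntegrable_exp_mul {v : ℝ → ℝ} (hv : Integrable v) (r a b : ℝ) :
    IntervalIntegrable (fun s => Real.exp (r * s) * v s) volume a b :=
  hv.intervalIntegrable.continuousOn_mul (by fun_prop)

lemma measurable_modeResponse {v : ℝ → ℝ} (hv : Integrable v) (T r : ℝ) :
    Measurable (modeResponse T r v) := by
  refine Measurable.indicator ?_ measurableSet_Ioc
  have h1 : Continuous fun t => ∫ s in (0 : ℝ)..t, Real.exp (r * s) * v s :=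
    intervalIntegral.continuous_primitive (intervalIntegrable_exp_mul hv r) 0
  exact (Continuous.mul (by fun_prop) h1).measurable

/-- The propagator e^{-r(t-s)} is at most e^{ΛT} for 0 < s ≤ t ≤ T. The bound depends on r only
through Λ, hence can serve all modes at once. -/
lemma abs_modeResponse_le {v : ℝ → ℝ} (hv : Integrable v) {T r Λ : ℝ} (hΛ : 0 ≤ Λ) (hr : -Λ ≤ r)
    (t : ℝ) : |modeResponse T r v t| ≤ Real.exp (Λ * T) * ∫ s, |v s| := by
  have hM : 0 ≤ Real.exp (Λ * T) * ∫ s, |v s| :=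
    mul_nonneg (Real.exp_pos _).le (integral_nonneg fun _ => abs_nonneg _)
  by_cases ht : t ∈ Ioc 0 T
  · rw [modeResponse, indicator_of_mem ht, ← intervalIntegral.integral_const_mul]
    have h1 : ‖∫ s in (0 : ℝ)..t, Real.exp (-(r * t)) * (Real.exp (r * s) * v s)‖ ≤
        ∫ s in (0 : ℝ)..t, Real.exp (Λ * T) * |v s| := by
      refine intervalIntegral.norm_integral_le_of_norm_le ht.1.le
        (Filter.Eventually.of_forall fun s hs => ?_) (hv.abs.intervalIntegrable.const_mul _)
      rw [← mul_assoc, ← Real.exp_add, norm_mul, Real.norm_eq_abs, Real.norm_eq_abs, Real.abs_exp]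
      refine mul_le_mul_of_nonneg_right (Real.exp_le_exp.2 ?_) (abs_nonneg _)
      nlinarith [mul_le_mul_of_nonneg_right hr (sub_nonneg.2 hs.2), hs.1,
        mul_le_mul_of_nonneg_left (show t - s ≤ T by linarith [ht.2, hs.1]) hΛ]
    rw [Real.norm_eq_abs] at h1
    refine h1.trans ?_
    rw [intervalIntegral.integral_const_mul, intervalIntegral.integral_of_le ht.1.le]
    exact mul_le_mul_of_nonneg_left (setIntegral_le_integral hv.abs
      (Filter.Eventually.of_forall fun _ => abs_nonneg _)) (Real.exp_pos _).le
  · rw [modeResponse, indicator_of_notMem ht, abs_zero]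
    exact hM

lemma memLp_modeResponse {v : ℝ → ℝ} (hv : Integrable v) (T r : ℝ) (p : ℝ≥0∞) :
    MemLp (fun t => (modeResponse T r v t : ℂ)) p := by
  have hm := measurable_modeResponse hv T r
  have h1 : MemLp (fun t => (modeResponse T r v t : ℂ)) p (volume.restrict (Ioc 0 T)) := by
    refine MemLp.of_bound (Complex.measurable_ofReal.comp hm).aestronglyMeasurable
      (Real.exp (|r| * T) * ∫ s, |v s|) (Filter.Eventually.of_forall fun t => ?_)
    rw [Complex.norm_real]
    exact abs_modeResponse_le hv (abs_nonneg r) (neg_abs_le r) t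
  rw [← memLp_indicator_iff_restrict measurableSet_Ioc] at h1
  convert h1 using 1
  ext t
  by_cases ht : t ∈ Ioc 0 T
  · simp [ht]
  · simp [ht, modeResponse]

/-- Integration by parts done through Fubini on the triangle s ≤ t, because g is merely integrable.
-/
lemma integral_mul_primitive {T : ℝ} (hT : 0 ≤ T) {g E P : ℝ → ℂ} (hg : IntegrableOn g (Ioc 0 T))
    (hE : Continuous E) (hP : ∀ t, HasDerivAt P (E t) t) :
    ∫ t in Ioc 0 T, E t * ∫ s in (0 : ℝ)..t, g s =
      P T * (∫ s in Ioc 0 T, g s) - ∫ s in Ioc 0 T, P s * g s := by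
  set μ := (volume : Measure ℝ).restrict (Ioc 0 T) with hμ
  have hEi : Integrable E μ :=
    (hE.integrableOn_Icc (a := 0) (b := T)).mono_set Ioc_subset_Icc_self
  set F : ℝ → ℝ → ℂ := fun t s => {p : ℝ × ℝ | p.2 ≤ p.1}.indicator (fun p => E p.1 * g p.2) (t, s)
    with hF
  have hFi : Integrable (Function.uncurry F) (μ.prod μ) :=
    (hEi.mul_prod hg).indicator (measurableSet_le measurable_snd measurable_fst)
  have hswap := integral_integral_swap hFi
  have h1 : ∫ t, (∫ s, F t s ∂μ) ∂μ = ∫ t in Ioc 0 T, E t * ∫ s in (0 : ℝ)..t, g s := by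
    refine setIntegral_congr_fun measurableSet_Ioc fun t ht => ?_
    rw [intervalIntegral.integral_of_le ht.1.le, ← integral_const_mul]
    have e : ∀ s, F t s = (Iic t).indicator (fun s => E t * g s) s := fun s => by
      simp [hF, indicator_apply]
    simp only [e]
    rw [integral_indicator measurableSet_Iic, hμ, Measure.restrict_restrict measurableSet_Iic]
    congr 2
    ext s
    simp only [mem_inter_iff, mem_Iic, mem_Ioc]
    exact ⟨fun h => ⟨h.2.1, h.1⟩, fun h => ⟨h.2, h.1, h.2.trans ht.2⟩⟩
  have h2 : ∫ s, (∫ t, F t s ∂μ) ∂μ = ∫ s in Ioc 0 T, (P T * g s - P s * g s) := by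
    refine setIntegral_congr_fun measurableSet_Ioc fun s hs => ?_
    have e : ∀ t, F t s = (Ici s).indicator (fun t => E t * g s) t := fun t => by
      simp [hF, indicator_apply]
    simp only [e]
    rw [integral_indicator measurableSet_Ici, hμ, Measure.restrict_restrict measurableSet_Ici,
      integral_mul_const]
    have e2 : Ici s ∩ Ioc 0 T = Icc s T := by
      ext t
      simp only [mem_inter_iff, mem_Ici, mem_Ioc, mem_Icc]
      exact ⟨fun h => ⟨h.1, h.2.2⟩, fun h => ⟨h.1, hs.1.trans_le h.1, h.2⟩⟩
    rw [e2, integral_Icc_eq_integral_Ioc, ← intervalIntegral.integral_of_le hs.2,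
      intervalIntegral.integral_eq_sub_of_hasDerivAt (fun t _ => hP t) (hE.intervalIntegrable _ _)]
    ring
  rw [← h1, hswap, h2]
  have hPc : Continuous P := continuous_iff_continuousAt.2 fun t => (hP t).continuousAt
  have hPg : IntegrableOn (fun s => P s * g s) (Ioc 0 T) := by
    rw [← intervalIntegrable_iff_integrableOn_Ioc_of_le hT] at hg ⊢
    exact hg.continuousOn_mul hPc.continuousOn
  rw [integral_sub (hg.const_mul _) hPg, integral_const_mul]

/-- The moment condition `h0` says that the response vanishes at T, which kills the boundary term.
With r ≠ 0 the symbol r + 2πiξ has no real zero. -/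
lemma fourier_modeResponse {T : ℝ} (hT : 0 ≤ T) {v : ℝ → ℝ} (hv : Integrable v)
    (hsupp : ∀ᵐ t : ℝ, t ∉ Icc 0 T → v t = 0) {r : ℝ} (hr : r ≠ 0)
    (h0 : ∫ s in (0 : ℝ)..T, Real.exp (r * s) * v s = 0) (ξ : ℝ) :
    𝓕 (fun t => (modeResponse T r v t : ℂ)) ξ =
      𝓕 (fun t => (v t : ℂ)) ξ / (r + 2 * Real.pi * ξ * Complex.I) := by
  set z : ℂ := r + 2 * Real.pi * ξ * Complex.I with hz
  have hz0 : z ≠ 0 := by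
    intro h
    apply hr
    have := congrArg Complex.re h
    simpa [hz] using this
  have hint := intervalIntegrable_exp_mul hv r 0 T
  rw [intervalIntegrable_iff_integrableOn_Ioc_of_le hT] at hint
  have key := integral_mul_primitive hT (g := fun s => ((Real.exp (r * s) * v s : ℝ) : ℂ))
    (E := fun t => Complex.exp (-(z * t))) (P := fun t => -Complex.exp (-(z * t)) / z)
    hint.ofReal (by fun_prop) (fun t => by
      have h1 : HasDerivAt (fun t : ℝ => -(z * (t : ℂ))) (-(z * 1)) t :=
        ((Complex.ofRealCLM.hasDerivAt (x := t)).const_mul z).neg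
      have h2 := (h1.cexp.neg).div_const z
      refine h2.congr_deriv ?_
      rw [div_eq_iff hz0]
      ring)
  rw [intervalIntegral.integral_of_le hT] at h0
  rw [integral_complex_ofReal, h0] at key
  simp only [Complex.ofReal_zero, mul_zero, zero_sub] at key
  have hL : 𝓕 (fun t => (modeResponse T r v t : ℂ)) ξ =
      ∫ t in Ioc 0 T, Complex.exp (-(z * t)) *
        ∫ s in (0 : ℝ)..t, ((Real.exp (r * s) * v s : ℝ) : ℂ) := by
    rw [Real.fourier_eq', ← integral_indicator measurableSet_Ioc]
    refine integral_congr_ae (Filter.Eventually.of_forall fun t => ?_)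
    simp only
    by_cases ht : t ∈ Ioc 0 T
    · rw [modeResponse, indicator_of_mem ht, indicator_of_mem ht, intervalIntegral.integral_ofReal,
        Complex.ofReal_mul (Real.exp _), Complex.ofReal_exp, smul_eq_mul, ← mul_assoc, ← Complex.exp_add]
      congr 2
      simp [hz]
      ring
    · simp [modeResponse, ht]
  have hR : 𝓕 (fun t => (v t : ℂ)) ξ = ∫ s in Ioc 0 T, Complex.exp (-(z * s)) *
      ((Real.exp (r * s) * v s : ℝ) : ℂ) := by
    rw [Real.fourier_eq', ← integral_Icc_eq_integral_Ioc, ← integral_indicator measurableSet_Icc]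
    refine integral_congr_ae ?_
    filter_upwards [hsupp] with t ht
    by_cases htI : t ∈ Icc 0 T
    · rw [indicator_of_mem htI, Complex.ofReal_mul (Real.exp _), Complex.ofReal_exp, ← mul_assoc,
        ← Complex.exp_add, smul_eq_mul]
      congr 2
      simp [hz]
      ring
    · simp [ht htI, htI]
  rw [hL, key, hR, ← integral_div, ← integral_neg]
  refine integral_congr_ae (Filter.Eventually.of_forall fun t => ?_)
  simp only
  ring

/-! ### Parseval's identity for sine coefficients -/

/-- The sine coefficient `∫₀¹ f(x) sin(nπx) dx`. -/
def sineCoeff (f : ℝ → ℝ) (n : ℤ) : ℝ := ∫ x in Ioo (0 : ℝ) 1, f x * Real.sin (n * Real.pi * x)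

/-- The odd extension to `(-1,1)` of a function on `(0,1)`. -/
def oddExt (f : ℝ → ℝ) (x : ℝ) : ℝ := (Ioo 0 1).indicator f x - (Ioo 0 1).indicator f (-x)

lemma oddExt_neg (f : ℝ → ℝ) (x : ℝ) : oddExt f (-x) = -oddExt f x := by
  simp [oddExt]

lemma oddExt_of_mem {f : ℝ → ℝ} {x : ℝ} (hx : x ∈ Ioo (0 : ℝ) 1) : oddExt f x = f x := by
  have : -x ∉ Ioo (0 : ℝ) 1 := fun h => absurd h.1 (by linarith [hx.1])
  simp [oddExt, hx, this]

lemma memLp_oddExt {f : ℝ → ℝ} (hf : MemLp f 2 (volume.restrict (Ioo 0 1))) :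
    MemLp (fun x => (oddExt f x : ℂ)) 2 := by
  have h1 := (memLp_indicator_iff_restrict measurableSet_Ioo).2 hf
  exact (h1.sub (h1.comp_measurePreserving (Measure.measurePreserving_neg volume))).ofReal

lemma integral_symm {E : Type*} [NormedAddCommGroup E] [NormedSpace ℝ E] {F : ℝ → E}
    (h : IntervalIntegrable F volume (-1) 1) :
    ∫ x in (-1 : ℝ)..1, F x = ∫ x in Ioo (0 : ℝ) 1, (F x + F (-x)) := by
  have h1 : IntervalIntegrable F volume 0 1 :=
    h.mono_set (by rw [uIcc_of_le (by norm_num), uIcc_of_le (by norm_num)]; exact Icc_subset_Icc (by norm_num) le_rfl)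
  have h2 : IntervalIntegrable F volume (-1) 0 :=
    h.mono_set (by rw [uIcc_of_le (by norm_num), uIcc_of_le (by norm_num)]; exact Icc_subset_Icc le_rfl (by norm_num))
  have h3 : IntervalIntegrable (fun x => F (-x)) volume 0 1 := by
    have := (IntervalIntegrable.iff_comp_neg (f := F)).1 h2
    simpa using this.symm
  rw [← integral_Ioc_eq_integral_Ioo, ← intervalIntegral.integral_of_le zero_le_one,
    ← intervalIntegral.integral_add_adjacent_intervals h2 h1, intervalIntegral.integral_add h1 h3,
    intervalIntegral.integral_comp_neg, add_comm]
  simp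

lemma fourierCoeffOn_oddExt {f : ℝ → ℝ} (hf : MemLp f 2 (volume.restrict (Ioo 0 1))) (n : ℤ) :
    ∫ x in (-1 : ℝ)..1, Complex.exp (-(Real.pi * n * x * Complex.I)) * (oddExt f x : ℂ) =
      -2 * Complex.I * sineCoeff f n := by
  have hi : IntervalIntegrable (fun x => (oddExt f x : ℂ)) volume (-1) 1 := by
    rw [intervalIntegrable_iff_integrableOn_Ioc_of_le (by norm_num)]
    exact ((memLp_oddExt hf).restrict _).integrable (by norm_num)
  rw [integral_symm (hi.continuousOn_mul (by fun_prop)), sineCoeff, ← integral_complex_ofReal,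
    ← integral_const_mul]
  refine setIntegral_congr_fun measurableSet_Ioo fun x hx => ?_
  simp only [oddExt_neg, oddExt_of_mem hx]
  push_cast
  rw [Complex.sin]
  have e1 : -(Real.pi * n * (-(x : ℂ)) * Complex.I) = n * Real.pi * x * Complex.I := by ring
  have e2 : -(Real.pi * n * (x : ℂ) * Complex.I) = -(n * Real.pi * x) * Complex.I := by ring
  rw [e1, e2]
  linear_combination ((f x : ℂ) * (Complex.exp (-(n * Real.pi * x) * Complex.I) -
    Complex.exp (n * Real.pi * x * Complex.I))) * Complex.I_sq

lemma hasSum_sq_of_fourier {H : ℝ → ℂ} (hH : MemLp H 2 (volume.restrict (Ioc (-1) 1))) {b : ℤ → ℝ}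
    (hb : ∀ n : ℤ, ∫ x in (-1 : ℝ)..1, Complex.exp (-(Real.pi * n * x * Complex.I)) * H x =
      -2 * Complex.I * b n) :
    HasSum (fun n => b n ^ 2) (2⁻¹ * ∫ x in (-1 : ℝ)..1, ‖H x‖ ^ 2) := by
  have h := hasSum_sq_fourierCoeffOn (by norm_num : (-1 : ℝ) < 1) hH
  convert h using 1
  · ext n
    rw [fourierCoeffOn_eq_integral]
    have e : ∫ x in (-1 : ℝ)..1, fourier (-n) (x : AddCircle (1 - (-1 : ℝ))) • H x =
        -2 * Complex.I * b n := by
      rw [← hb n]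
      refine intervalIntegral.integral_congr fun x _ => ?_
      simp only [fourier_coe_apply, smul_eq_mul]
      congr 2
      push_cast
      ring
    rw [e, norm_smul, mul_pow, norm_mul, mul_pow, Complex.norm_real, Real.norm_eq_abs, sq_abs]
    simp
    ring
  · norm_num

lemma memLp_exp_mul {H : ℝ → ℂ} {μ : Measure ℝ} (hH : MemLp H 2 μ) (k : ℤ) :
    MemLp (fun x : ℝ => Complex.exp (Real.pi * k * x * Complex.I) * H x) 2 μ := by
  refine hH.of_le ?_ (Filter.Eventually.of_forall fun x => ?_)
  · exact (Continuous.aestronglyMeasurable (by fun_prop)).mul hH.aestronglyMeasurable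
  · rw [norm_mul, show (Real.pi * k * x * Complex.I : ℂ) = ((Real.pi * k * x : ℝ) : ℂ) * Complex.I by
      push_cast; ring, Complex.norm_exp_ofReal_mul_I, one_mul]

/-- Polarization: multiplying the odd extension by 1 + e^{iπkx} changes the coefficients from c_n to
c_n + c_{n-k}, and |1 + e^{iθ}|² = 2 + 2cos θ. Subtracting the two plain Parseval sums isolates the
products. -/
lemma hasSum_sineCoeff_mul {f : ℝ → ℝ} (hf : MemLp f 2 (volume.restrict (Ioo 0 1))) (k : ℤ) :
    HasSum (fun n => sineCoeff f n * sineCoeff f (n - k))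
      (∫ x in Ioo (0 : ℝ) 1, f x ^ 2 * Real.cos (k * Real.pi * x)) := by
  set Y : ℝ → ℂ := fun x => (oddExt f x : ℂ) with hY
  have hYm : MemLp Y 2 (volume.restrict (Ioc (-1) 1)) := (memLp_oddExt hf).restrict _
  set H : ℝ → ℂ := fun x => Y x + Complex.exp (Real.pi * k * x * Complex.I) * Y x with hH
  have hHm : MemLp H 2 (volume.restrict (Ioc (-1) 1)) := hYm.add (memLp_exp_mul hYm k)
  have hYi : IntervalIntegrable Y volume (-1) 1 := by
    rw [intervalIntegrable_iff_integrableOn_Ioc_of_le (by norm_num)]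
    exact hYm.integrable (by norm_num)
  have h1 := hasSum_sq_of_fourier hYm (fourierCoeffOn_oddExt hf)
  have h2 := hasSum_sq_of_fourier hHm (b := fun n => sineCoeff f n + sineCoeff f (n - k)) (by
    intro n
    have e : ∀ x : ℝ, Complex.exp (-(Real.pi * n * x * Complex.I)) * H x =
        Complex.exp (-(Real.pi * n * x * Complex.I)) * Y x +
        Complex.exp (-(Real.pi * (n - k : ℤ) * x * Complex.I)) * Y x := by
      intro x
      rw [hH]
      simp only
      rw [mul_add, ← mul_assoc, ← Complex.exp_add]
      congr 3
      push_cast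
      ring
    simp only [e]
    rw [intervalIntegral.integral_add (hYi.continuousOn_mul (by fun_prop))
      (hYi.continuousOn_mul (by fun_prop)), fourierCoeffOn_oddExt hf, fourierCoeffOn_oddExt hf]
    push_cast
    ring)
  have h3 : HasSum (fun n => sineCoeff f (n - k) ^ 2) (2⁻¹ * ∫ x in (-1 : ℝ)..1, ‖Y x‖ ^ 2) :=
    (Equiv.subRight k).hasSum_iff (f := fun n => sineCoeff f n ^ 2) |>.2 h1
  have h4 := ((h2.sub h1).sub h3).mul_left (1 / 2)
  have hYsq : ∀ x, ‖Y x‖ ^ 2 = oddExt f x ^ 2 := fun x => by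
    rw [hY, Complex.norm_real, Real.norm_eq_abs, sq_abs]
  have hHsq : ∀ x, ‖H x‖ ^ 2 = oddExt f x ^ 2 * (2 + 2 * Real.cos (k * Real.pi * x)) := fun x => by
    have e : H x = (1 + Complex.exp (((Real.pi * k * x : ℝ) : ℂ) * Complex.I)) * Y x := by
      rw [hH]; push_cast; ring
    rw [e, norm_mul, mul_pow, hYsq, ← Complex.normSq_eq_norm_sq, Complex.exp_mul_I, ← Complex.ofReal_cos,
      ← Complex.ofReal_sin, Complex.normSq_apply]
    rw [show Real.pi * k * x = k * Real.pi * x by ring]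
    simp only [Complex.add_re, Complex.one_re, Complex.ofReal_re, Complex.mul_re, Complex.I_re,
      mul_zero, Complex.ofReal_im, Complex.I_im, mul_one, sub_self, add_zero, Complex.add_im,
      Complex.one_im, Complex.mul_im, zero_add]
    linear_combination (oddExt f x ^ 2) * Real.sin_sq_add_cos_sq (k * Real.pi * x)
  have hsqi : IntervalIntegrable (fun x => oddExt f x ^ 2) volume (-1) 1 := by
    rw [intervalIntegrable_iff_integrableOn_Ioc_of_le (by norm_num)]
    have := hYm.integrable_norm_pow (p := 2) (by norm_num)
    simp only [hYsq] at this
    exact this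
  have hsqi' : IntegrableOn (fun x => f x ^ 2) (Ioo 0 1) := hf.integrable_sq
  have hfc : IntegrableOn (fun x => f x ^ 2 * Real.cos (k * Real.pi * x)) (Ioo 0 1) :=
    hsqi'.mul_bdd (c := 1) (Continuous.aestronglyMeasurable (by fun_prop))
      (Filter.Eventually.of_forall fun x => Real.abs_cos_le_one _)
  have hval : 1 / 2 * (2⁻¹ * (∫ x in (-1 : ℝ)..1, ‖H x‖ ^ 2) - 2⁻¹ * (∫ x in (-1 : ℝ)..1, ‖Y x‖ ^ 2)
      - 2⁻¹ * ∫ x in (-1 : ℝ)..1, ‖Y x‖ ^ 2) =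
      ∫ x in Ioo (0 : ℝ) 1, f x ^ 2 * Real.cos (k * Real.pi * x) := by
    simp only [hYsq, hHsq]
    rw [integral_symm hsqi, integral_symm (hsqi.mul_continuousOn (by fun_prop))]
    have a1 : ∫ x in Ioo (0 : ℝ) 1, (oddExt f x ^ 2 + oddExt f (-x) ^ 2) =
        ∫ x in Ioo (0 : ℝ) 1, 2 * f x ^ 2 :=
      setIntegral_congr_fun measurableSet_Ioo fun x hx => by
        simp only [oddExt_neg, oddExt_of_mem hx]; ring
    have a2 : ∫ x in Ioo (0 : ℝ) 1, (oddExt f x ^ 2 * (2 + 2 * Real.cos (k * Real.pi * x)) +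
        oddExt f (-x) ^ 2 * (2 + 2 * Real.cos (k * Real.pi * -x))) =
        ∫ x in Ioo (0 : ℝ) 1, (4 * f x ^ 2 + 4 * (f x ^ 2 * Real.cos (k * Real.pi * x))) :=
      setIntegral_congr_fun measurableSet_Ioo fun x hx => by
        simp only [oddExt_neg, oddExt_of_mem hx, mul_neg, Real.cos_neg]; ring
    rw [a1, a2, integral_add (hsqi'.const_mul 4) (hfc.const_mul 4), integral_const_mul,
      integral_const_mul, integral_const_mul]
    ring
  rw [hval] at h4
  have hfun : (fun n => sineCoeff f n * sineCoeff f (n - k)) = fun n => 1 / 2 *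
      ((sineCoeff f n + sineCoeff f (n - k)) ^ 2 - sineCoeff f n ^ 2 - sineCoeff f (n - k) ^ 2) := by
    funext n
    ring
  rw [hfun]
  exact h4

/-! ### Sine coefficients of the solution of the heat equation -/

lemma memLp_of_continuous_Ioo {E : Type*} [NormedAddCommGroup E] [SecondCountableTopologyEither ℝ E]
    {F : ℝ → E} (hF : Continuous F) (p : ℝ≥0∞) (a b : ℝ) : MemLp F p (volume.restrict (Ioo a b)) := by
  obtain ⟨C, hC⟩ := isCompact_Icc.exists_bound_of_continuousOn (s := Icc a b) hF.continuousOn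
  refine MemLp.of_bound hF.aestronglyMeasurable C ?_
  filter_upwards [ae_restrict_mem measurableSet_Ioo] with x hx
  exact hC x (Ioo_subset_Icc_self hx)

lemma integral_Ioo_mul_deriv {F F' ψ : ℝ → ℝ} {a b : ℝ} (hab : a ≤ b)
    (hF : ∀ x, HasDerivAt F (F' x) x) (hF' : Continuous F') (hψ : ContDiff ℝ ∞ ψ)
    (hs : tsupport ψ ⊆ Ioo a b) :
    ∫ x in Ioo a b, F x * deriv ψ x = -∫ x in Ioo a b, F' x * ψ x := by
  have h1 := intervalIntegral.integral_mul_deriv_eq_deriv_mul (a := a) (b := b) (u := F) (v := ψ)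
    (u' := F') (v' := deriv ψ) (fun x _ => hF x)
    (fun x _ => (hψ.differentiable (by simp) x).hasDerivAt)
    (hF'.intervalIntegrable _ _) ((hψ.continuous_deriv (by simp)).intervalIntegrable _ _)
  have ha : ψ a = 0 := image_eq_zero_of_notMem_tsupport fun h => lt_irrefl _ (hs h).1
  have hb : ψ b = 0 := image_eq_zero_of_notMem_tsupport fun h => lt_irrefl _ (hs h).2
  rw [ha, hb] at h1
  simpa [intervalIntegral.integral_of_le hab, integral_Ioc_eq_integral_Ioo] using h1

lemma isWeakDeriv_of_hasDerivAt {f g : L2} {F F' : ℝ → ℝ}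
    (hf : f =ᵐ[volume.restrict (Ioo 0 1)] F) (hg : g =ᵐ[volume.restrict (Ioo 0 1)] F')
    (hF : ∀ x, HasDerivAt F (F' x) x) (hF' : Continuous F') : IsWeakDeriv f g := by
  intro ψ hψ _ hs
  have h1 : ∫ x in Ioo (0 : ℝ) 1, f x * deriv ψ x = ∫ x in Ioo (0 : ℝ) 1, F x * deriv ψ x := by
    refine integral_congr_ae ?_
    filter_upwards [hf] with x hx
    rw [hx]
  have h2 : ∫ x in Ioo (0 : ℝ) 1, g x * ψ x = ∫ x in Ioo (0 : ℝ) 1, F' x * ψ x := by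
    refine integral_congr_ae ?_
    filter_upwards [hg] with x hx
    rw [hx]
  rw [h1, h2]
  exact integral_Ioo_mul_deriv zero_le_one hF hF' hψ hs

def sineMode (n : ℤ) : L2 :=
  (memLp_of_continuous_Ioo (F := fun x : ℝ => Real.sin (n * Real.pi * x)) (by fun_prop) 2 0 1).toLp _

def cosineMode (n : ℤ) : L2 :=
  (memLp_of_continuous_Ioo (F := fun x : ℝ => Real.cos (n * Real.pi * x)) (by fun_prop) 2 0 1).toLp _

lemma smul_sineMode_ae (c : ℝ) (n : ℤ) : (c • sineMode n : L2) =ᵐ[volume.restrict (Ioo 0 1)]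
    fun x => c * Real.sin (n * Real.pi * x) := by
  filter_upwards [Lp.coeFn_smul c (sineMode n), MemLp.coeFn_toLp (memLp_of_continuous_Ioo
    (F := fun x : ℝ => Real.sin (n * Real.pi * x)) (by fun_prop) 2 0 1)] with x h1 h2
  rw [h1, Pi.smul_apply, smul_eq_mul, sineMode, h2]

lemma smul_cosineMode_ae (c : ℝ) (n : ℤ) : (c • cosineMode n : L2) =ᵐ[volume.restrict (Ioo 0 1)]
    fun x => c * Real.cos (n * Real.pi * x) := by
  filter_upwards [Lp.coeFn_smul c (cosineMode n), MemLp.coeFn_toLp (memLp_of_continuous_Ioo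
    (F := fun x : ℝ => Real.cos (n * Real.pi * x)) (by fun_prop) 2 0 1)] with x h1 h2
  rw [h1, Pi.smul_apply, smul_eq_mul, cosineMode, h2]

/-- The solution `e^{n²π²t} sin(nπx)` of the backward heat equation is a test function. -/
lemma isTestFunction_backward_mode {S : ℝ} (hS : 0 ≤ S) (n : ℤ) :
    IsTestFunction S (fun t => Real.exp (((n : ℝ) * Real.pi) ^ 2 * t) • sineMode n)
      (fun t => (((n : ℝ) * Real.pi) ^ 2 * Real.exp (((n : ℝ) * Real.pi) ^ 2 * t)) • sineMode n)
      (fun t => (((n : ℝ) * Real.pi) * Real.exp (((n : ℝ) * Real.pi) ^ 2 * t)) • cosineMode n)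
      (fun t => -((((n : ℝ) * Real.pi) ^ 2 * Real.exp (((n : ℝ) * Real.pi) ^ 2 * t)) • sineMode n))
      := by
  have hsin : ∀ c x : ℝ, HasDerivAt (fun x => c * Real.sin (n * Real.pi * x))
      (c * (n * Real.pi) * Real.cos (n * Real.pi * x)) x := fun c x => by
    have := ((((hasDerivAt_id x).const_mul (n * Real.pi : ℝ)).sin).const_mul c)
    refine this.congr_deriv ?_
    simp only [id]
    ring
  have hcos : ∀ c x : ℝ, HasDerivAt (fun x => c * Real.cos (n * Real.pi * x))
      (-(c * (n * Real.pi)) * Real.sin (n * Real.pi * x)) x := fun c x => by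
    have := ((((hasDerivAt_id x).const_mul (n * Real.pi : ℝ)).cos).const_mul c)
    refine this.congr_deriv ?_
    simp only [id]
    ring
  have hexp : ∀ t : ℝ, HasDerivAt (fun t => Real.exp (((n : ℝ) * Real.pi) ^ 2 * t))
      (((n : ℝ) * Real.pi) ^ 2 * Real.exp (((n : ℝ) * Real.pi) ^ 2 * t)) t := fun t => by
    have := ((hasDerivAt_id t).const_mul (((n : ℝ) * Real.pi) ^ 2)).exp
    refine this.congr_deriv ?_
    simp only [id]
    ring
  refine ⟨by fun_prop, by fun_prop, fun t _ => ?_, fun t _ => ?_, ?_, ?_, ?_, ?_⟩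
  · refine isWeakDeriv_of_hasDerivAt (smul_sineMode_ae _ n) (smul_cosineMode_ae _ n)
      (fun x => (hsin _ x).congr_deriv ?_) (by fun_prop)
    ring
  · refine ⟨fun x => Real.exp (((n : ℝ) * Real.pi) ^ 2 * t) * Real.sin (n * Real.pi * x),
      by fun_prop, smul_sineMode_ae _ n, by simp, by simp [Real.sin_int_mul_pi]⟩
  · exact memLp_of_continuous_Ioo (by fun_prop) 2 0 S
  · refine Filter.Eventually.of_forall fun t => ?_
    simp only [← neg_smul]
    refine isWeakDeriv_of_hasDerivAt (smul_cosineMode_ae _ n) (smul_sineMode_ae _ n)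
      (fun x => (hcos _ x).congr_deriv ?_) (by fun_prop)
    ring
  · exact memLp_of_continuous_Ioo (by fun_prop) 2 0 S
  · intro θ hθ _ hs
    simp only [smul_smul]
    rw [integral_smul_const, integral_smul_const, ← neg_smul]
    congr 1
    have := integral_Ioo_mul_deriv hS hexp (by fun_prop) hθ hs
    simp only [mul_comm (deriv θ _), mul_comm (θ _)]
    exact this

lemma integral_sin_int_mul_pi (n : ℤ) : ∫ x in Ioo (0 : ℝ) 1, Real.sin (n * Real.pi * x) =
    if Odd n then 2 / (n * Real.pi) else 0 := by
  rw [← integral_Ioc_eq_integral_Ioo, ← intervalIntegral.integral_of_le zero_le_one]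
  rcases eq_or_ne n 0 with rfl | hn
  · simp
  · have hn' : (n : ℝ) * Real.pi ≠ 0 := mul_ne_zero (by exact_mod_cast hn) Real.pi_ne_zero
    rw [intervalIntegral.integral_comp_mul_left (fun x => Real.sin x) hn', integral_sin]
    split_ifs with h
    · rw [mul_one, Real.cos_int_mul_pi, h.neg_one_zpow]
      simp
      field_simp
      norm_num
    · rw [mul_one, Real.cos_int_mul_pi, (Int.not_odd_iff_even.1 h).neg_one_zpow]
      simp

lemma sineCoeff_heatSolution {u : ℝ → ℝ} {y : ℝ → L2} (h : IsHeatSolution u 0 y) {τ : ℝ}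
    (hτ : 0 ≤ τ) (n : ℤ) :
    sineCoeff (y τ) n * Real.exp (((n : ℝ) * Real.pi) ^ 2 * τ) =
      (if Odd n then 2 / (n * Real.pi) else 0) *
        ∫ t in (0 : ℝ)..τ, Real.exp (((n : ℝ) * Real.pi) ^ 2 * t) * u t := by
  -- The horizon τ + 1 is positive even when τ = 0. The test function is annihilated by ∂ₜ + ∂ₓₓ, so
  -- only the value at τ and the source term survive.
  have hw := h.weakForm (τ + 1) (by linarith) _ _ _ _
    (isTestFunction_backward_mode (by linarith : 0 ≤ τ + 1) n) τ ⟨hτ, by linarith⟩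
  have e1 : ∫ x in Ioo (0 : ℝ) 1, y τ x *
      (Real.exp (((n : ℝ) * Real.pi) ^ 2 * τ) • sineMode n : L2) x =
      sineCoeff (y τ) n * Real.exp (((n : ℝ) * Real.pi) ^ 2 * τ) := by
    rw [sineCoeff, ← integral_mul_const]
    refine integral_congr_ae ?_
    filter_upwards [smul_sineMode_ae (Real.exp (((n : ℝ) * Real.pi) ^ 2 * τ)) n] with x hx
    rw [hx]
    ring
  have e2 : ∫ x in Ioo (0 : ℝ) 1, (0 : L2) x *
      (Real.exp (((n : ℝ) * Real.pi) ^ 2 * 0) • sineMode n : L2) x = 0 := by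
    rw [integral_eq_zero_of_ae]
    filter_upwards [Lp.coeFn_zero ℝ 2 (volume.restrict (Ioo (0 : ℝ) 1))] with x hx
    rw [hx]
    simp
  have e3 : ∀ (t : ℝ) (w : L2), ∫ x in Ioo (0 : ℝ) 1, y t x * (w x + (-w : L2) x) = 0 := by
    intro t w
    rw [integral_eq_zero_of_ae]
    filter_upwards [Lp.coeFn_neg w] with x hx
    rw [hx]
    simp
  have e4 : ∀ t : ℝ, ∫ x in Ioo (0 : ℝ) 1, u t *
      (Real.exp (((n : ℝ) * Real.pi) ^ 2 * t) • sineMode n : L2) x =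
      (if Odd n then 2 / (n * Real.pi) else 0) * (Real.exp (((n : ℝ) * Real.pi) ^ 2 * t) * u t) := by
    intro t
    rw [← integral_sin_int_mul_pi, ← integral_mul_const]
    refine integral_congr_ae ?_
    filter_upwards [smul_sineMode_ae (Real.exp (((n : ℝ) * Real.pi) ^ 2 * t)) n] with x hx
    rw [hx]
    ring
  rw [e1, e2] at hw
  simp only [e3, e4] at hw
  rw [intervalIntegral.integral_const_mul] at hw
  simpa using hw

/-! ### The quadratic form in frequency variables -/

/-- The control multiplied by the square root `e^{2π²h²t}` of the time weight of `phi (2h)`. -/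
def weightedControl (h : ℕ) (u : ℝ → ℝ) (t : ℝ) : ℝ :=
  Real.exp (2 * (h * Real.pi) ^ 2 * t) * u t

lemma integrable_weightedControl {T : ℝ} {u : ℝ → ℝ} (hu : Integrable u)
    (hsupp : ∀ᵐ t : ℝ, t ∉ Icc 0 T → u t = 0) (h : ℕ) : Integrable (weightedControl h u) := by
  refine (hu.norm.const_mul (Real.exp (2 * (h * Real.pi) ^ 2 * T))).mono'
    ((Continuous.aestronglyMeasurable (by fun_prop)).mul hu.aestronglyMeasurable) ?_
  filter_upwards [hsupp] with t ht
  by_cases htI : t ∈ Icc 0 T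
  · rw [weightedControl, norm_mul, Real.norm_eq_abs, Real.abs_exp]
    gcongr
    exact htI.2
  · simp [weightedControl, ht htI]

lemma weightedControl_ae_eq_zero {T : ℝ} {u : ℝ → ℝ}
    (hsupp : ∀ᵐ t : ℝ, t ∉ Icc 0 T → u t = 0) (h : ℕ) :
    ∀ᵐ t : ℝ, t ∉ Icc 0 T → weightedControl h u t = 0 := by
  filter_upwards [hsupp] with t ht htn
  simp [weightedControl, ht htn]

lemma exp_modeRate_mul_weightedControl (h : ℕ) (n : ℤ) (u : ℝ → ℝ) (s : ℝ) :
    Real.exp (Real.pi ^ 2 * modeRate h n * s) * weightedControl h u s =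
      Real.exp ((n * Real.pi) ^ 2 * s) * u s := by
  rw [weightedControl, ← mul_assoc, ← Real.exp_add]
  congr 2
  rw [modeRate]
  ring

lemma sineCoeff_eq_modeResponse {u : ℝ → ℝ} {y : ℝ → L2} (hy : IsHeatSolution u 0 y) (h : ℕ)
    {n : ℤ} (hn : Odd n) {T t : ℝ} (ht : t ∈ Ioc 0 T) :
    Real.exp (2 * (h * Real.pi) ^ 2 * t) * sineCoeff (y t) n =
      2 / (n * Real.pi) * modeResponse T (Real.pi ^ 2 * modeRate h n) (weightedControl h u) t := by
  have h1 := sineCoeff_heatSolution hy ht.1.le n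
  rw [if_pos hn] at h1
  rw [modeResponse, indicator_of_mem ht]
  simp only [exp_modeRate_mul_weightedControl]
  rw [mul_left_comm, ← h1, mul_comm (sineCoeff _ _), ← mul_assoc, ← Real.exp_add]
  congr 2
  rw [modeRate]
  ring

lemma sineCoeff_eq_zero_of_not_odd {u : ℝ → ℝ} {y : ℝ → L2} (hy : IsHeatSolution u 0 y)
    {n : ℤ} (hn : ¬Odd n) {t : ℝ} (ht : 0 ≤ t) : sineCoeff (y t) n = 0 := by
  have h1 := sineCoeff_heatSolution hy ht n
  rw [if_neg hn, zero_mul] at h1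
  exact (mul_eq_zero.1 h1).resolve_right (Real.exp_ne_zero _)

lemma integral_exp_mul_weightedControl {u : ℝ → ℝ} {y : ℝ → L2} (hy : IsHeatSolution u 0 y) (h : ℕ)
    {n : ℤ} (hn : Odd n) {T : ℝ} (hT : 0 ≤ T) (hyT : y T = 0) :
    ∫ s in (0 : ℝ)..T, Real.exp (Real.pi ^ 2 * modeRate h n * s) * weightedControl h u s = 0 := by
  have h1 := sineCoeff_heatSolution hy hT n
  have h0 : sineCoeff (y T) n = 0 := by
    rw [hyT, sineCoeff, integral_eq_zero_of_ae]
    filter_upwards [Lp.coeFn_zero ℝ 2 (volume.restrict (Ioo (0 : ℝ) 1))] with x hx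
    rw [hx]
    simp
  have hn0 : (n : ℝ) ≠ 0 := by
    rintro h
    have : n = 0 := by exact_mod_cast h
    rw [this] at hn
    exact absurd hn (by decide)
  rw [h0, zero_mul, if_pos hn] at h1
  simp only [exp_modeRate_mul_weightedControl]
  exact (mul_eq_zero.1 h1.symm).resolve_left (by have := Real.pi_ne_zero; positivity)

/-- In Parseval with shift 2h only odd n contribute; since h is odd they are exactly n = 2l + h,
with partner n - 2h = 2l - h. The factor π²/4 cancels the two coefficients 2/(nπ). -/
lemma hasSum_modeResponse {u : ℝ → ℝ} {y : ℝ → L2} (hy : IsHeatSolution u 0 y) {h : ℕ} (hh : Odd h)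
    {T t : ℝ} (ht : t ∈ Ioc 0 T) :
    HasSum (fun l : ℤ => (modeProd h l)⁻¹ *
        (modeResponse T (Real.pi ^ 2 * modeRate h (2 * l + h)) (weightedControl h u) t *
        modeResponse T (Real.pi ^ 2 * modeRate h (2 * l - h)) (weightedControl h u) t))
      (Real.pi ^ 2 / 4 * Real.exp (4 * (h * Real.pi) ^ 2 * t) *
        ∫ x in Ioo (0 : ℝ) 1, y t x ^ 2 * Real.cos ((2 * h : ℕ) * Real.pi * x)) := by
  have h1 := (hasSum_sineCoeff_mul (Lp.memLp (y t)) (2 * h : ℕ)).mul_left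
    (Real.pi ^ 2 / 4 * Real.exp (4 * (h * Real.pi) ^ 2 * t))
  have hinj : Function.Injective fun l : ℤ => 2 * l + (h : ℤ) := fun a b hab => by
    simp only at hab; omega
  rw [← hinj.hasSum_iff] at h1
  · have e : ∀ l : ℤ, (modeProd h l)⁻¹ *
        (modeResponse T (Real.pi ^ 2 * modeRate h (2 * l + h)) (weightedControl h u) t *
        modeResponse T (Real.pi ^ 2 * modeRate h (2 * l - h)) (weightedControl h u) t) =
        Real.pi ^ 2 / 4 * Real.exp (4 * (h * Real.pi) ^ 2 * t) *
        (sineCoeff (y t) (2 * l + h) * sineCoeff (y t) (2 * l + h - (2 * h : ℕ))) := by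
      intro l
      have a1 := sineCoeff_eq_modeResponse hy h (odd_two_mul_add hh l) ht
      have a2 := sineCoeff_eq_modeResponse hy h (odd_two_mul_sub hh l) ht
      have hA := modeProd_ne_zero hh l
      have hA' : modeProd h l = (2 * l + h : ℤ) * (2 * l - h : ℤ) := by
        rw [modeProd]; push_cast; ring
      rw [hA'] at hA ⊢
      have b1 := left_ne_zero_of_mul hA
      have b2 := right_ne_zero_of_mul hA
      rw [show (2 * l + h - (2 * h : ℕ) : ℤ) = 2 * l - h by push_cast; ring,
        show Real.exp (4 * (h * Real.pi) ^ 2 * t) = Real.exp (2 * (h * Real.pi) ^ 2 * t) *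
          Real.exp (2 * (h * Real.pi) ^ 2 * t) by rw [← Real.exp_add]; congr 1; ring]
      generalize modeResponse T (Real.pi ^ 2 * modeRate h (2 * l + h)) (weightedControl h u) t = w1 at *
      generalize modeResponse T (Real.pi ^ 2 * modeRate h (2 * l - h)) (weightedControl h u) t = w2 at *
      generalize sineCoeff (y t) (2 * l + h) = c1 at *
      generalize sineCoeff (y t) (2 * l - h) = c2 at *
      generalize Real.exp (2 * (h * Real.pi) ^ 2 * t) = E at *
      have : Real.pi ^ 2 / 4 * (E * E) * (c1 * c2) = Real.pi ^ 2 / 4 * ((E * c1) * (E * c2)) := by ring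
      rw [this, a1, a2]
      have := Real.pi_ne_zero
      field_simp
      norm_num
    simp only [e]
    exact h1
  · intro n hn
    have hn' : ¬Odd n := by
      rintro ⟨j, rfl⟩
      obtain ⟨i, hi⟩ := hh
      exact hn ⟨j - i, by simp only [hi]; push_cast; ring⟩
    rw [sineCoeff_eq_zero_of_not_odd hy hn' ht.1.le, zero_mul, mul_zero]

lemma memLp_fourier {f : ℝ → ℂ} (h1 : Integrable f) (h2 : MemLp f 2) : MemLp (𝓕 f) 2 :=
  (Lp.memLp (𝓕 (h2.toLp f) : Lp ℂ 2 (volume : Measure ℝ))).ae_eq (fourier_toLp_ae h1 h2)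

lemma re_conj_div_mul_div (V : ℂ) (c p q s : ℝ) :
    ((starRingEnd ℂ) (V / (c * (p + s * Complex.I))) * (V / (c * (q + s * Complex.I)))).re =
      (c ^ 2)⁻¹ * (‖V‖ ^ 2 * ((p * q + s ^ 2) / ((p ^ 2 + s ^ 2) * (q ^ 2 + s ^ 2)))) := by
  have hN : ∀ r : ℝ, Complex.normSq (r + s * Complex.I) = r ^ 2 + s ^ 2 := fun r => by
    rw [Complex.normSq_add_mul_I]
  have hV : (((‖V‖ ^ 2 : ℝ)) : ℂ) = (starRingEnd ℂ) V * V := by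
    rw [← Complex.normSq_eq_conj_mul_self, Complex.normSq_eq_norm_sq]
  have e : (starRingEnd ℂ) (V / (c * (p + s * Complex.I))) * (V / (c * (q + s * Complex.I))) =
      (((c ^ 2)⁻¹ * (‖V‖ ^ 2 * ((p ^ 2 + s ^ 2)⁻¹ * (q ^ 2 + s ^ 2)⁻¹)) : ℝ) : ℂ) *
        ((p * q + s ^ 2 : ℝ) + (s * q - p * s : ℝ) * Complex.I) := by
    rw [div_eq_mul_inv, div_eq_mul_inv, mul_inv, mul_inv, Complex.inv_def (p + s * Complex.I),
      Complex.inv_def (q + s * Complex.I), hN, hN, Complex.ofReal_mul (c ^ 2)⁻¹,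
      Complex.ofReal_mul (‖V‖ ^ 2), hV]
    simp only [map_mul, map_inv₀, map_add, map_neg, neg_neg, Complex.conj_ofReal, Complex.conj_I]
    push_cast
    linear_combination (-(c : ℂ)⁻¹ ^ 2 * ((starRingEnd ℂ) V * V) * ((p : ℂ) ^ 2 + s ^ 2)⁻¹ *
      ((q : ℂ) ^ 2 + s ^ 2)⁻¹ * (s : ℂ) ^ 2) * Complex.I_sq
  rw [e, Complex.re_ofReal_mul, Complex.add_re, Complex.ofReal_re, Complex.re_ofReal_mul,
    Complex.I_re, mul_zero, add_zero, div_eq_mul_inv, mul_inv]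
  ring

lemma integral_modeResponse_mul {T : ℝ} (hT : 0 ≤ T) {v : ℝ → ℝ} (hv : Integrable v)
    (hsupp : ∀ᵐ t : ℝ, t ∉ Icc 0 T → v t = 0) {p q : ℝ} (hp : p ≠ 0) (hq : q ≠ 0)
    (hp0 : ∫ s in (0 : ℝ)..T, Real.exp (Real.pi ^ 2 * p * s) * v s = 0)
    (hq0 : ∫ s in (0 : ℝ)..T, Real.exp (Real.pi ^ 2 * q * s) * v s = 0) :
    ∫ t, modeResponse T (Real.pi ^ 2 * p) v t * modeResponse T (Real.pi ^ 2 * q) v t =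
      (Real.pi ^ 4)⁻¹ * ∫ ξ, ‖𝓕 (fun t => (v t : ℂ)) ξ‖ ^ 2 *
        ((p * q + (2 / Real.pi * ξ) ^ 2) /
          ((p ^ 2 + (2 / Real.pi * ξ) ^ 2) * (q ^ 2 + (2 / Real.pi * ξ) ^ 2))) := by
  have hpi := Real.pi_ne_zero
  have hint : ∀ r, Integrable fun t => (modeResponse T r v t : ℂ) := fun r =>
    memLp_one_iff_integrable.1 (memLp_modeResponse hv T r 1)
  have h2 : ∀ r, MemLp (fun t => (modeResponse T r v t : ℂ)) 2 := fun r =>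
    memLp_modeResponse hv T r 2
  have key := integral_conj_fourier_mul_fourier (hint (Real.pi ^ 2 * p)) (h2 _)
    (hint (Real.pi ^ 2 * q)) (h2 _)
  have e1 : ∫ t, (starRingEnd ℂ) (modeResponse T (Real.pi ^ 2 * p) v t : ℂ) *
      (modeResponse T (Real.pi ^ 2 * q) v t : ℂ) =
      ((∫ t, modeResponse T (Real.pi ^ 2 * p) v t * modeResponse T (Real.pi ^ 2 * q) v t : ℝ) : ℂ) := by
    rw [← integral_complex_ofReal]
    refine integral_congr_ae (Filter.Eventually.of_forall fun t => ?_)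
    simp
  rw [e1] at key
  have hI : Integrable fun ξ => (starRingEnd ℂ)
      (𝓕 (fun t => (modeResponse T (Real.pi ^ 2 * p) v t : ℂ)) ξ) *
      𝓕 (fun t => (modeResponse T (Real.pi ^ 2 * q) v t : ℂ)) ξ :=
    (memLp_fourier (hint _) (h2 _)).star.integrable_mul (memLp_fourier (hint _) (h2 _))
  have key2 := congrArg Complex.re key
  rw [Complex.ofReal_re] at key2
  rw [← key2, ← integral_const_mul]
  refine (integral_re hI).symm.trans ?_
  refine integral_congr_ae (Filter.Eventually.of_forall fun ξ => ?_)
  simp only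
  rw [fourier_modeResponse hT hv hsupp (by positivity) hp0,
    fourier_modeResponse hT hv hsupp (by positivity) hq0]
  generalize 𝓕 (fun t => (v t : ℂ)) ξ = V
  -- Chosen so that π²r + 2πiξ = π²(r + is).
  set s : ℝ := 2 / Real.pi * ξ with hs
  have hz : ∀ r : ℝ, ((Real.pi ^ 2 * r : ℝ) : ℂ) + 2 * Real.pi * ξ * Complex.I =
      (Real.pi ^ 2 : ℝ) * (r + s * Complex.I) := fun r => by
    rw [hs]
    push_cast
    have : (Real.pi : ℂ) ≠ 0 := by exact_mod_cast hpi
    field_simp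
  rw [hz, hz]
  rw [RCLike.re_eq_complex_re, re_conj_div_mul_div]
  ring

/-! ### Coercivity of the quadratic form -/

/-- The kernel of the quadratic form in the frequency variable `ξ`. -/
def frequencyKernel (h : ℕ) (ξ : ℝ) : ℝ :=
  ∑' l, (modeProd h l)⁻¹ * modeInteraction h l (2 / Real.pi * ξ)

lemma continuous_modeInteraction {h : ℕ} (hh : Odd h) (l : ℤ) : Continuous (modeInteraction h l) := by
  unfold modeInteraction
  refine Continuous.div (by fun_prop) (by fun_prop) fun s => ?_
  have h1 := one_le_modeRate_sq (h := h) (odd_two_mul_add hh l)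
  have h2 := one_le_modeRate_sq (h := h) (odd_two_mul_sub hh l)
  positivity

lemma continuous_frequencyKernel {h : ℕ} (hh : Odd h) : Continuous (frequencyKernel h) := by
  refine continuous_tsum (u := fun l => |(modeProd h l)⁻¹|) (fun l => ?_)
    (hasSum_inv_modeProd hh).summable.abs fun l ξ => ?_
  · exact ((continuous_modeInteraction hh l).comp (by fun_prop)).const_mul _
  · rw [norm_mul, Real.norm_eq_abs, Real.norm_eq_abs]
    refine mul_le_of_le_one_right (abs_nonneg _) ((abs_modeInteraction_le hh l _).trans ?_)
    rw [div_le_one (by positivity)]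
    nlinarith [sq_nonneg (2 / Real.pi * ξ)]

lemma integrable_decay : Integrable fun ξ : ℝ => 1 / (1 + (2 / Real.pi * ξ) ^ 2) := by
  have := integrable_inv_one_add_sq.comp_mul_left' (R := 2 / Real.pi) (by positivity)
  simpa [one_div] using this

lemma abs_frequencyKernel_le {h : ℕ} (hh : Odd h) (ξ : ℝ) :
    |frequencyKernel h ξ| ≤ (∑' l, |(modeProd h l)⁻¹|) * (1 / (1 + (2 / Real.pi * ξ) ^ 2)) := by
  rw [frequencyKernel, ← tsum_mul_right, ← Real.norm_eq_abs]
  refine tsum_of_norm_bounded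
    ((hasSum_inv_modeProd hh).summable.abs.mul_right _).hasSum fun l => ?_
  rw [norm_mul, Real.norm_eq_abs, Real.norm_eq_abs]
  exact mul_le_mul_of_nonneg_left (abs_modeInteraction_le hh l _) (abs_nonneg _)

lemma exists_frequencyKernel_le {h : ℕ} (hh : h = 1 ∨ h = 5) :
    ∃ κ : ℝ, 0 < κ ∧ ∀ ξ, frequencyKernel h ξ ≤ -κ * (sobolevWeight ξ)⁻¹ := by
  obtain ⟨κ, hκ, hle⟩ := exists_kernel_le hh
  refine ⟨κ, hκ, fun ξ => (hle _).trans ?_⟩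
  rw [sobolevWeight, ← Real.rpow_neg (by positivity), neg_mul, neg_mul, neg_le_neg_iff]
  refine mul_le_mul_of_nonneg_left ?_ hκ.le
  apply Real.rpow_le_rpow_of_nonpos (by positivity) _ (by norm_num)
  rw [mul_pow, mul_pow]
  -- The kernel variable 2ξ/π is smaller in modulus than the angular frequency 2πξ, so passing to
  -- the Sobolev weight only weakens the bound.
  have h1 : (2 / Real.pi) ^ 2 ≤ (2 * Real.pi) ^ 2 := by
    have h3 := Real.pi_gt_three
    gcongr
    rw [div_le_iff₀ (by linarith)]
    nlinarith
  gcongr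

lemma deriv_phi (k : ℕ) (t x : ℝ) : deriv (fun x' => phi k t x') x =
    k * Real.pi * Real.exp ((k * Real.pi) ^ 2 * t) * Real.cos (k * Real.pi * x) := by
  have h := (((hasDerivAt_id x).const_mul (k * Real.pi : ℝ)).sin).const_mul
    (Real.exp (Real.pi ^ 2 * (k : ℝ) ^ 2 * t))
  have h2 : HasDerivAt (fun x' => phi k t x') _ x := h
  rw [h2.deriv, show Real.pi ^ 2 * (k : ℝ) ^ 2 * t = (k * Real.pi) ^ 2 * t by ring]
  simp only [id]
  ring

lemma hasSum_integral_modeResponse {v : ℝ → ℝ} (hv : Integrable v) {h : ℕ} (hh : Odd h) {T : ℝ}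
    {F : ℝ → ℝ} (hF : ∀ t ∈ Ioc 0 T, HasSum (fun l : ℤ => (modeProd h l)⁻¹ *
        (modeResponse T (Real.pi ^ 2 * modeRate h (2 * l + h)) v t *
        modeResponse T (Real.pi ^ 2 * modeRate h (2 * l - h)) v t)) (F t)) :
    HasSum (fun l : ℤ => (modeProd h l)⁻¹ *
        ∫ t, modeResponse T (Real.pi ^ 2 * modeRate h (2 * l + h)) v t *
        modeResponse T (Real.pi ^ 2 * modeRate h (2 * l - h)) v t) (∫ t in Ioc 0 T, F t) := by
  -- All rates are at least -Λ, so all responses share the bound M, and the absolutely summable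
  -- 1/`modeProd` permits integration term by term.
  set Λ : ℝ := Real.pi ^ 2 * (2 * (h : ℝ) ^ 2) with hΛ
  set M : ℝ := Real.exp (Λ * T) * ∫ s, |v s| with hM
  have hr : ∀ n, -Λ ≤ Real.pi ^ 2 * modeRate h n := fun n => by
    rw [hΛ, modeRate, ← mul_neg]
    refine mul_le_mul_of_nonneg_left ?_ (sq_nonneg _)
    nlinarith [sq_nonneg (n : ℝ)]
  have hb : ∀ n t, |modeResponse T (Real.pi ^ 2 * modeRate h n) v t| ≤ M := fun n t =>
    abs_modeResponse_le hv (by positivity) (hr n) t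
  have hprod : ∀ n m t, |modeResponse T (Real.pi ^ 2 * modeRate h n) v t *
      modeResponse T (Real.pi ^ 2 * modeRate h m) v t| ≤ M * M := fun n m t => by
    rw [abs_mul]
    exact mul_le_mul (hb n t) (hb m t) (abs_nonneg _) ((abs_nonneg _).trans (hb n t))
  have hnorm : ∀ (l : ℤ) t, ‖(modeProd h l)⁻¹ *
        (modeResponse T (Real.pi ^ 2 * modeRate h (2 * l + h)) v t *
        modeResponse T (Real.pi ^ 2 * modeRate h (2 * l - h)) v t)‖ ≤
        |(modeProd h l)⁻¹| * (M * M) := fun l t => by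
    rw [norm_mul, Real.norm_eq_abs, Real.norm_eq_abs]
    exact mul_le_mul_of_nonneg_left (hprod _ _ t) (abs_nonneg _)
  have hint : ∀ l : ℤ, Integrable (fun t => (modeProd h l)⁻¹ *
        (modeResponse T (Real.pi ^ 2 * modeRate h (2 * l + h)) v t *
        modeResponse T (Real.pi ^ 2 * modeRate h (2 * l - h)) v t)) (volume.restrict (Ioc 0 T)) :=
    fun l => Integrable.of_bound (((measurable_modeResponse hv T _).mul
      (measurable_modeResponse hv T _)).const_mul _).aestronglyMeasurable _
      (Filter.Eventually.of_forall (hnorm l))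
  have hsum := hasSum_integral_of_summable_integral_norm hint (by
    refine Summable.of_nonneg_of_le (fun l => integral_nonneg fun t => norm_nonneg _)
      (fun l => ?_) ((((hasSum_inv_modeProd hh).summable.abs.mul_right (M * M)).mul_right
        ((volume : Measure ℝ).real (Ioc 0 T))))
    refine (integral_mono (hint l).norm (integrable_const _) (hnorm l)).trans (le_of_eq ?_)
    rw [integral_const, smul_eq_mul, measureReal_restrict_apply_univ, mul_comm])
  have e1 : ∫ t in Ioc 0 T, F t = ∫ t in Ioc 0 T, ∑' l : ℤ, (modeProd h l)⁻¹ *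
        (modeResponse T (Real.pi ^ 2 * modeRate h (2 * l + h)) v t *
        modeResponse T (Real.pi ^ 2 * modeRate h (2 * l - h)) v t) :=
    setIntegral_congr_fun measurableSet_Ioc fun t ht => (hF t ht).tsum_eq.symm
  have e2 : ∀ l : ℤ, (modeProd h l)⁻¹ *
        ∫ t, modeResponse T (Real.pi ^ 2 * modeRate h (2 * l + h)) v t *
        modeResponse T (Real.pi ^ 2 * modeRate h (2 * l - h)) v t =
      ∫ t in Ioc 0 T, (modeProd h l)⁻¹ *
        (modeResponse T (Real.pi ^ 2 * modeRate h (2 * l + h)) v t *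
        modeResponse T (Real.pi ^ 2 * modeRate h (2 * l - h)) v t) := fun l => by
    rw [← integral_const_mul, setIntegral_eq_integral_of_forall_compl_eq_zero]
    intro t ht
    simp [modeResponse, ht]
  rw [e1]
  simp only [e2]
  exact hsum

lemma hasSum_integral_modeInteraction {V : ℝ → ℂ} (hVc : Continuous V) {M : ℝ}
    (hV : ∀ ξ, ‖V ξ‖ ≤ M) {h : ℕ} (hh : Odd h) :
    HasSum (fun l : ℤ => (modeProd h l)⁻¹ *
        ∫ ξ, ‖V ξ‖ ^ 2 * modeInteraction h l (2 / Real.pi * ξ))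
      (∫ ξ, ‖V ξ‖ ^ 2 * frequencyKernel h ξ) := by
  have hnorm : ∀ (l : ℤ) ξ, ‖(modeProd h l)⁻¹ *
      (‖V ξ‖ ^ 2 * modeInteraction h l (2 / Real.pi * ξ))‖ ≤
      |(modeProd h l)⁻¹| * (M ^ 2 * (1 / (1 + (2 / Real.pi * ξ) ^ 2))) := fun l ξ => by
    rw [norm_mul, norm_mul, norm_pow, norm_norm, Real.norm_eq_abs, Real.norm_eq_abs]
    gcongr
    · exact hV ξ
    · exact abs_modeInteraction_le hh l _
  have hint : ∀ l : ℤ, Integrable fun ξ => (modeProd h l)⁻¹ *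
      (‖V ξ‖ ^ 2 * modeInteraction h l (2 / Real.pi * ξ)) := fun l => by
    refine ((integrable_decay.const_mul (M ^ 2)).const_mul _).mono' ?_
      (Filter.Eventually.of_forall (hnorm l))
    exact (((hVc.norm.pow 2).mul ((continuous_modeInteraction hh l).comp
      (by fun_prop : Continuous fun ξ : ℝ => 2 / Real.pi * ξ))).const_mul _).aestronglyMeasurable
  have hsum := hasSum_integral_of_summable_integral_norm hint (by
    refine Summable.of_nonneg_of_le (fun l => integral_nonneg fun t => norm_nonneg _)
      (fun l => ?_) ((hasSum_inv_modeProd hh).summable.abs.mul_right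
        (∫ ξ : ℝ, M ^ 2 * (1 / (1 + (2 / Real.pi * ξ) ^ 2))))
    refine (integral_mono (hint l).norm ((integrable_decay.const_mul (M ^ 2)).const_mul _)
      (hnorm l)).trans (le_of_eq ?_)
    rw [integral_const_mul])
  have e1 : ∀ ξ, ∑' l : ℤ, (modeProd h l)⁻¹ *
      (‖V ξ‖ ^ 2 * modeInteraction h l (2 / Real.pi * ξ)) = ‖V ξ‖ ^ 2 * frequencyKernel h ξ := fun ξ => by
    rw [frequencyKernel, ← tsum_mul_left]
    refine tsum_congr fun l => ?_
    ring
  simp only [e1, integral_const_mul] at hsum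
  exact hsum

/-- The same series over l is summed once in time, by Parseval in x, and once in frequency, by
Plancherel in t; the sums agree by uniqueness. -/
lemma integral_sq_mul_deriv_phi {T : ℝ} (hT : 0 ≤ T) {u : ℝ → ℝ} {y : ℝ → L2} (hu : Integrable u)
    (hsupp : ∀ᵐ t : ℝ, t ∉ Icc 0 T → u t = 0) (hy : IsHeatSolution u 0 y) (hyT : y T = 0) {h : ℕ}
    (hh : Odd h) :
    ∫ t in (0 : ℝ)..T, ∫ x in Ioo (0 : ℝ) 1,
        y t x ^ 2 * deriv (fun x' => phi (2 * h) t x') x =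
      8 * h / Real.pi ^ 5 *
        ∫ ξ, ‖𝓕 (fun t => (weightedControl h u t : ℂ)) ξ‖ ^ 2 * frequencyKernel h ξ := by
  have hv := integrable_weightedControl hu hsupp h
  have hvs := weightedControl_ae_eq_zero hsupp h
  have h1 := hasSum_integral_modeResponse hv hh (T := T) fun t ht => hasSum_modeResponse hy hh ht
  have hvC : Integrable fun t => (weightedControl h u t : ℂ) := hv.ofReal
  have h2 := hasSum_integral_modeInteraction (continuous_fourier_of_integrable hvC)
    (norm_fourier_le_integral_norm _) hh
  have h3 := h2.mul_left (Real.pi ^ 4)⁻¹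
  have hne : ∀ n : ℤ, Odd n → modeRate h n ≠ 0 := fun n hn h0 => by
    have := one_le_modeRate_sq (h := h) hn
    rw [h0] at this
    norm_num at this
  have e : ∀ l : ℤ, (modeProd h l)⁻¹ *
        ∫ t, modeResponse T (Real.pi ^ 2 * modeRate h (2 * l + h)) (weightedControl h u) t *
        modeResponse T (Real.pi ^ 2 * modeRate h (2 * l - h)) (weightedControl h u) t =
      (Real.pi ^ 4)⁻¹ * ((modeProd h l)⁻¹ * ∫ ξ, ‖𝓕 (fun t => (weightedControl h u t : ℂ)) ξ‖ ^ 2 *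
        modeInteraction h l (2 / Real.pi * ξ)) := fun l => by
    rw [integral_modeResponse_mul hT hv hvs (hne _ (odd_two_mul_add hh l))
      (hne _ (odd_two_mul_sub hh l))
      (integral_exp_mul_weightedControl hy h (odd_two_mul_add hh l) hT hyT)
      (integral_exp_mul_weightedControl hy h (odd_two_mul_sub hh l) hT hyT), mul_left_comm]
    rfl
  simp only [e] at h1
  have h4 := h1.unique h3
  have e2 : ∀ t, ∫ x in Ioo (0 : ℝ) 1, y t x ^ 2 * deriv (fun x' => phi (2 * h) t x') x =
      8 * h / Real.pi * (Real.pi ^ 2 / 4 * Real.exp (4 * (h * Real.pi) ^ 2 * t) *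
        ∫ x in Ioo (0 : ℝ) 1, y t x ^ 2 * Real.cos ((2 * h : ℕ) * Real.pi * x)) := fun t => by
    rw [← integral_const_mul, ← integral_const_mul]
    refine integral_congr_ae (Filter.Eventually.of_forall fun x => ?_)
    simp only
    rw [deriv_phi, show (((2 * h : ℕ) : ℝ) * Real.pi) ^ 2 * t = 4 * (h * Real.pi) ^ 2 * t by
      push_cast; ring]
    have := Real.pi_ne_zero
    push_cast
    field_simp
    ring
  simp only [e2]
  rw [intervalIntegral.integral_of_le hT, integral_const_mul, h4]
  have := Real.pi_ne_zero
  field_simp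

lemma dualEnergy_eq_ofReal {V : ℝ → ℂ} (hVc : Continuous V) {M : ℝ} (hV : ∀ ξ, ‖V ξ‖ ≤ M) :
    Integrable (fun ξ => (sobolevWeight ξ)⁻¹ * ‖V ξ‖ ^ 2) ∧
      dualEnergy V = ENNReal.ofReal (∫ ξ, (sobolevWeight ξ)⁻¹ * ‖V ξ‖ ^ 2) := by
  have hi : Integrable (fun ξ => (sobolevWeight ξ)⁻¹ * ‖V ξ‖ ^ 2) := by
    refine integrable_inv_sobolevWeight.mul_bdd (c := M ^ 2) (hVc.norm.pow 2).aestronglyMeasurable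
      (Filter.Eventually.of_forall fun ξ => ?_)
    rw [norm_pow, norm_norm]
    gcongr
    exact hV ξ
  refine ⟨hi, ?_⟩
  rw [ofReal_integral_eq_lintegral_ofReal hi (Filter.Eventually.of_forall fun ξ =>
    mul_nonneg (inv_nonneg.2 (sobolevWeight_pos ξ).le) (sq_nonneg _))]
  refine lintegral_congr fun ξ => ?_
  rw [ENNReal.ofReal_mul (inv_nonneg.2 (sobolevWeight_pos ξ).le),
    ENNReal.ofReal_pow (norm_nonneg _), ofReal_norm]

/-- The squared dual norm of the control is bounded by the `H^{-5/4}(ℝ)` energy of the weighted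
control. -/
lemma exists_dualSobolevNorm_sq_le (T : ℝ) (h : ℕ) :
    ∃ C : ℝ, 0 < C ∧ ∀ u : ℝ → ℝ, Integrable u → (∀ᵐ t : ℝ, t ∉ Icc 0 T → u t = 0) →
      dualSobolevNorm (5 / 4) (Ioo 0 T) u ≠ ⊤ ∧
      (dualSobolevNorm (5 / 4) (Ioo 0 T) u).toReal ^ 2 ≤
        C * ∫ ξ, (sobolevWeight ξ)⁻¹ * ‖𝓕 (fun t => (weightedControl h u t : ℂ)) ξ‖ ^ 2 := by
  -- This exponent undoes the weight, recovering u from the weighted control.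
  obtain ⟨C, hC, hle⟩ := exists_dualEnergy_exp_mul_le T (-(2 * (h * Real.pi) ^ 2))
  refine ⟨C.toReal + 1, by positivity, fun u hu hsupp => ?_⟩
  have hv := integrable_weightedControl hu hsupp h
  have h1 := hle (fun t => (weightedControl h u t : ℂ)) hv.ofReal (by
    filter_upwards [weightedControl_ae_eq_zero hsupp h] with t ht htn
    rw [ht htn, Complex.ofReal_zero])
  have e : (fun t : ℝ => (weightedControl h u t : ℂ) *
      Complex.exp (((-(2 * (h * Real.pi) ^ 2) : ℝ) : ℂ) * t)) = fun t => (u t : ℂ) := by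
    funext t
    rw [← Complex.ofReal_mul, ← Complex.ofReal_exp, ← Complex.ofReal_mul, weightedControl,
      mul_right_comm, ← Real.exp_add]
    congr 1
    rw [show 2 * (h * Real.pi) ^ 2 * t + -(2 * (h * Real.pi) ^ 2) * t = 0 by ring, Real.exp_zero,
      one_mul]
  have hvC : Integrable fun t => (weightedControl h u t : ℂ) := hv.ofReal
  rw [e, (dualEnergy_eq_ofReal (continuous_fourier_of_integrable hvC)
    (norm_fourier_le_integral_norm _)).2] at h1
  set I := ∫ ξ, (sobolevWeight ξ)⁻¹ * ‖𝓕 (fun t => (weightedControl h u t : ℂ)) ξ‖ ^ 2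
  have hI : 0 ≤ I := integral_nonneg fun ξ =>
    mul_nonneg (inv_nonneg.2 (sobolevWeight_pos ξ).le) (sq_nonneg _)
  have h2 := dualSobolevNorm_le hu hsupp
  have h3 : dualSobolevNorm (5 / 4) (Ioo 0 T) u ^ 2 ≤ C * ENNReal.ofReal I := by
    calc _ ≤ (dualEnergy (𝓕 fun t => (u t : ℂ)) ^ (1 / 2 : ℝ)) ^ 2 := by gcongr
      _ = dualEnergy (𝓕 fun t => (u t : ℂ)) := by
        rw [← ENNReal.rpow_natCast, ← ENNReal.rpow_mul]; norm_num
      _ ≤ _ := h1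
  have h4 : C * ENNReal.ofReal I < ⊤ := ENNReal.mul_lt_top hC ENNReal.ofReal_lt_top
  refine ⟨fun htop => ?_, ?_⟩
  · rw [htop] at h3
    exact absurd (h3.trans_lt h4) (by simp)
  · have h5 := ENNReal.toReal_mono h4.ne h3
    rw [ENNReal.toReal_pow, ENNReal.toReal_mul, ENNReal.toReal_ofReal hI] at h5
    nlinarith

lemma exists_coercive (T : ℝ) (hT : 0 < T) {h : ℕ} (hh : h = 1 ∨ h = 5) :
    ∃ C : ℝ, 0 < C ∧ ∀ (u : ℝ → ℝ) (y : ℝ → L2), Integrable u →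
      (∀ᵐ t : ℝ, t ∉ Icc 0 T → u t = 0) → IsHeatSolution u 0 y → y T = 0 →
      dualSobolevNorm (5 / 4) (Ioo 0 T) u ≠ ⊤ ∧
      ∫ t in (0 : ℝ)..T, ∫ x in Ioo (0 : ℝ) 1,
          y t x ^ 2 * deriv (fun x' => phi (2 * h) t x') x ≤
        -C * (dualSobolevNorm (5 / 4) (Ioo 0 T) u).toReal ^ 2 := by
  have hodd : Odd h := by rcases hh with rfl | rfl <;> decide
  have hh0 : (0 : ℝ) < h := by exact_mod_cast hodd.pos
  obtain ⟨κ, hκ, hker⟩ := exists_frequencyKernel_le hh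
  obtain ⟨C, hC, hdual⟩ := exists_dualSobolevNorm_sq_le T h
  -- The prefactor of the frequency form times the coercivity constant of the kernel, divided by the
  -- cost of passing from the dual norm of u to the energy of the weighted control.
  refine ⟨8 * h / Real.pi ^ 5 * κ / C, by have := Real.pi_pos; positivity,
    fun u y hu hsupp hy hyT => ⟨(hdual u hu hsupp).1, ?_⟩⟩
  have hv := integrable_weightedControl hu hsupp h
  have hvC : Integrable fun t => (weightedControl h u t : ℂ) := hv.ofReal
  have hVc := continuous_fourier_of_integrable hvC
  have hVb := norm_fourier_le_integral_norm (fun t => (weightedControl h u t : ℂ))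
  have hE := (dualEnergy_eq_ofReal hVc hVb).1
  have hle := (hdual u hu hsupp).2
  rw [integral_sq_mul_deriv_phi hT.le hu hsupp hy hyT hodd]
  have hKi : Integrable fun ξ => ‖𝓕 (fun t => (weightedControl h u t : ℂ)) ξ‖ ^ 2 *
      frequencyKernel h ξ := by
    refine Integrable.bdd_mul (c := (∫ t, ‖(weightedControl h u t : ℂ)‖) ^ 2)
      ((integrable_decay.const_mul (∑' l, |(modeProd h l)⁻¹|)).mono'
        (continuous_frequencyKernel hodd).aestronglyMeasurable
        (Filter.Eventually.of_forall fun ξ => abs_frequencyKernel_le hodd ξ))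
      (hVc.norm.pow 2).aestronglyMeasurable (Filter.Eventually.of_forall fun ξ => ?_)
    rw [norm_pow, norm_norm]
    gcongr
    exact hVb ξ
  have hK : ∫ ξ, ‖𝓕 (fun t => (weightedControl h u t : ℂ)) ξ‖ ^ 2 * frequencyKernel h ξ ≤
      -κ * ∫ ξ, (sobolevWeight ξ)⁻¹ * ‖𝓕 (fun t => (weightedControl h u t : ℂ)) ξ‖ ^ 2 := by
    rw [← integral_const_mul]
    refine integral_mono hKi (hE.const_mul _) fun ξ => ?_
    simp only
    rw [← mul_assoc, mul_comm]
    exact mul_le_mul_of_nonneg_right (hker ξ) (sq_nonneg _)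
  set I := ∫ ξ, (sobolevWeight ξ)⁻¹ * ‖𝓕 (fun t => (weightedControl h u t : ℂ)) ξ‖ ^ 2
  have hc : 0 < 8 * h / Real.pi ^ 5 := by have := Real.pi_pos; positivity
  set c : ℝ := 8 * h / Real.pi ^ 5
  calc _ ≤ c * (-κ * I) := mul_le_mul_of_nonneg_left hK hc.le
    _ = -(c * κ / C) * (C * I) := by field_simp
    _ ≤ _ := by
      rw [neg_mul, neg_mul, neg_le_neg_iff]
      exact mul_le_mul_of_nonneg_left hle (by positivity)

end BurgersHeat

end

/-! ### Conclusion for k₀ = 2h, with h = 1 and h = 5 -/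

theorem proposition4p1 (T : ℝ) (hT : 0 < T) :
    ∃ C : ℝ, 0 < C ∧
      ∀ (u₁ : ℝ → ℝ) (y₁ : ℝ → BurgersHeat.L2),
        MeasureTheory.Integrable u₁ →
        (∀ᵐ t : ℝ, t ∉ Set.Icc 0 T → u₁ t = 0) →
        BurgersHeat.IsHeatSolution u₁ 0 y₁ →
        y₁ T = 0 →
        BurgersHeat.dualSobolevNorm (5 / 4) (Set.Ioo 0 T) u₁ ≠ ⊤ ∧
        ∀ k₀ ∈ ({2, 10} : Set ℕ),
          ∫ t in (0 : ℝ)..T, ∫ x in Set.Ioo (0 : ℝ) 1,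
              (y₁ t x) ^ 2 * deriv (fun x' : ℝ => BurgersHeat.phi k₀ t x') x
            ≤ -C * (BurgersHeat.dualSobolevNorm (5 / 4) (Set.Ioo 0 T) u₁).toReal ^ 2 := by
  obtain ⟨C₁, hC₁, h₁⟩ := BurgersHeat.exists_coercive T hT (h := 1) (Or.inl rfl)
  obtain ⟨C₂, hC₂, h₂⟩ := BurgersHeat.exists_coercive T hT (h := 5) (Or.inr rfl)
  refine ⟨min C₁ C₂, lt_min hC₁ hC₂, fun u y hu hsupp hy hyT => ?_⟩
  obtain ⟨hfin, h1⟩ := h₁ u y hu hsupp hy hyT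
  obtain ⟨-, h2⟩ := h₂ u y hu hsupp hy hyT
  refine ⟨hfin, fun k₀ hk => ?_⟩
  rcases hk with rfl | rfl
  · refine h1.trans (mul_le_mul_of_nonneg_right (neg_le_neg (min_le_left _ _)) (sq_nonneg _))
  · refine h2.trans (mul_le_mul_of_nonneg_right (neg_le_neg (min_le_right _ _)) (sq_nonneg _))
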